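/- Let $\lambda>-1/2$ and $\rho>1$. Let $C_n^{\mu}$ denote the Gegenbauer polynomials, defined by $C_0^\mu=1$, $C_1^\mu(x)=2\mu x$ and $nC_n^\mu(x)=2(n+\mu-1)x\,C_{n-1}^\mu(x)-(n+2\mu-2)C_{n-2}^\mu(x)$ for $n\ge 2$. Let $\mathcal E_\rho=\{\tfrac12(w+w^{-1}) : w\in\mathbb C,\ |w|=\rho\}$ be the Bernstein ellipse, which has foci $\pm1$ and sum of semi-axes $\rho$. For a function $u$ analytic on and within $\mathcal E_\rho$, put $M_\rho=\max_{z\in\mathcal E_\rho}|u(z)|$. There is a sequence of positive constants $c=c_n$, depending only on $\lambda$, $\rho$ and $n$, with $c_n\to1$ as $n\to\infty$, such that the following holds for every $n\ge1$. The Gegenbauer–Gauss–Lobatto points $x_0,\dots,x_n$, that is, the real zeros of $(1-x^2)C_{n-1}^{\lambda+1}(x)$, are $n+1$ distinct points, and for every $u$ analytic on and within $\mathcal E_\rho$, with $I_nu$ the Lagrange interpolation polynomial of $u$ of degree at most $n$ at these points: (a) $$\max_{|x|\le1}|(u-I_nu)(x)|\le \frac{4c_n M_\rho\sqrt{\rho^2+\rho^{-2}}\,(1+\rho^{-2})^{\lambda+1}}{(1-\rho^{-1})^2(\rho-\rho^{-1})^2}\,\frac{\Gamma(\lambda+1)}{\Gamma(2\lambda+2)}\,\frac{n^{\lambda+1}}{\rho^n};$$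 (b) $$\max_{0\le j\le n}|(u-I_nu)'(x_j)|\le \frac{8c_n M_\rho\sqrt{\rho^2+\rho^{-2}}\,(1+\rho^{-2})^{\lambda+1}}{(1-\rho^{-1})^2(\rho-\rho^{-1})^2}\,\frac{\Gamma(\lambda+2)}{\Gamma(2\lambda+4)}\,\frac{n^{\lambda+3}}{\rho^n}.$$ -/

import Mathlib

open Polynomial

noncomputable section

/-- The Gegenbauer polynomial `C_n^l` with real parameter `l`, given by the three-term recurrence
`n C_n = 2 (n + l - 1) x C_{n-1} - (n + 2 l - 2) C_{n-2}` for `n ≥ 2`,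
with `C_0 = 1` and `C_1 = 2 l x`. -/
def gegenbauer (l : ℝ) : ℕ → ℝ[X]
  | 0 => 1
  | 1 => C (2 * l) * X
  | n + 2 =>
    C (((n + 2 : ℕ) : ℝ)⁻¹) *
      (C (2 * (((n + 2 : ℕ) : ℝ) + l - 1)) * X * gegenbauer l (n + 1)
        - C (((n + 2 : ℕ) : ℝ) + 2 * l - 2) * gegenbauer l n)

/-- The Bernstein ellipse: the image of the circle `‖w‖ = ρ` under `w ↦ (w + w⁻¹) / 2`. -/
def bernsteinEllipse (ρ : ℝ) : Set ℂ :=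
  {z | ∃ w : ℂ, ‖w‖ = ρ ∧ z = (w + w⁻¹) / 2}

/-- The closed region on and within the Bernstein ellipse, which has foci `±1` and
major axis of length `ρ + ρ⁻¹`. -/
def bernsteinRegion (ρ : ℝ) : Set ℂ :=
  {z | ‖z - 1‖ + ‖z + 1‖ ≤ ρ + ρ⁻¹}

/-- `M_ρ`, the maximum of `‖u z‖` over the Bernstein ellipse. -/
def maxOnEllipse (ρ : ℝ) (u : ℂ → ℂ) : ℝ :=
  sSup ((fun z => ‖u z‖) '' bernsteinEllipse ρ)

/-- The Gegenbauer-Gauss-Lobatto points, that is, the zeros of `(1 - x ^ 2) C_{n-1}^{l+1}(x)`;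
used for `1 ≤ n` only. -/
def lobattoNodes (l : ℝ) (n : ℕ) : Finset ℝ :=
  ((1 - X ^ 2) * gegenbauer (l + 1) (n - 1)).roots.toFinset

/-- The Lagrange interpolation polynomial of `u` at the Gegenbauer-Gauss-Lobatto points. -/
def lobattoInterp (l : ℝ) (n : ℕ) (u : ℂ → ℂ) : ℂ[X] :=
  Lagrange.interpolate (lobattoNodes l n) (fun x : ℝ => (x : ℂ)) (fun x : ℝ => u (x : ℂ))

end

/-! Put `m = l + 1`, `k = n - 1` and `p = (1 - X^2) C_k^m`. Hermite's contour formula gives `2πi (u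
- I_n u)(x) = p(x) ∮ u(z) / (p(z) (z - x)) dz` over the ellipse, so a bound `K |p(x)|` for the error
needs three facts: the ellipse has length at most `π √(ρ² + ρ⁻²)`, the distance `|z - x|` is at
least `(ρ - 1)² / (2ρ)`, and `|p(z)|` is bounded below. With `z = (w + w⁻¹) / 2` the factor `|1 -
z²|` equals `|w - w⁻¹|² / 4`. The sharp ingredient is `exists_lower_bound_gegenbauer`. The
generating function expands `C_k^m(z)` as `(m)_k / k! * w^k` times a polynomial in `w⁻²` whose
coefficients converge, with domination, to those of `(1 - v)^(-m)` at `v = w⁻²`; the modulus of this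
limit is at least `(1 + ρ⁻²)^(-m)`. On `[-1, 1]`, `|p|` is at most `C_k^m(1) = (2m)_k / k!`, and
`(2m)_k / (m)_k` is asymptotic to `k^m Γ(m) / Γ(2m)`. This gives (a). At a node both the error and
`p` vanish, so the bound `K |p|` passes to derivatives (`norm_deriv_le_of_norm_le_mul`), and (b)
follows from a bound of `p'` by about `n² / (2m + 1) * C_k^m(1)`. -/

section GegenbauerLobatto
open Filter Topology

/-! ### Recurrences and differential identities for Gegenbauer polynomials. -/

theorem gegenbauer_recurrence (m : ℝ) (n : ℕ) :
    C ((n : ℝ) + 2) * gegenbauer m (n + 2) =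
      C (2 * (n + 1 + m)) * X * gegenbauer m (n + 1) - C (n + 2 * m) * gegenbauer m n := by
  rw [gegenbauer, ← mul_assoc, ← C_mul]
  have h : ((n : ℝ) + 2) * ((n + 2 : ℕ) : ℝ)⁻¹ = 1 := by
    push_cast
    exact mul_inv_cancel₀ (by positivity)
  rw [h, C_1, one_mul]
  push_cast
  congr 4 <;> ring

theorem gegenbauer_zero (m : ℝ) : gegenbauer m 0 = 1 := by rw [gegenbauer]

theorem gegenbauer_one (m : ℝ) : gegenbauer m 1 = C (2 * m) * X := by rw [gegenbauer]

theorem gegenbauer_eval_zero (m x : ℝ) : (gegenbauer m 0).eval x = 1 := by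
  simp [gegenbauer_zero]

theorem gegenbauer_eval_one (m x : ℝ) : (gegenbauer m 1).eval x = 2 * m * x := by
  simp [gegenbauer_one]

theorem gegenbauer_eval_recurrence (m x : ℝ) (n : ℕ) :
    ((n : ℝ) + 2) * (gegenbauer m (n + 2)).eval x =
      2 * (n + 1 + m) * x * (gegenbauer m (n + 1)).eval x
        - (n + 2 * m) * (gegenbauer m n).eval x := by
  have := congrArg (eval x) (gegenbauer_recurrence m n)
  simpa only [eval_mul, eval_sub, eval_C, eval_X] using this

theorem gegenbauer_aeval_recurrence (m : ℝ) (z : ℂ) (n : ℕ) :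
    ((n : ℂ) + 2) * aeval z (gegenbauer m (n + 2)) =
      2 * (n + 1 + m) * z * aeval z (gegenbauer m (n + 1))
        - (n + 2 * m) * aeval z (gegenbauer m n) := by
  have := congrArg (aeval z) (gegenbauer_recurrence m n)
  simpa [aeval_C] using this

theorem natDegree_gegenbauer_le (m : ℝ) (n : ℕ) : (gegenbauer m n).natDegree ≤ n := by
  induction n using Nat.twoStepInduction with
  | zero => simp [gegenbauer_zero]
  | one => rw [gegenbauer_one]; exact (natDegree_C_mul_le _ _).trans natDegree_X_le
  | more n h0 h1 =>
    rw [gegenbauer]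
    refine natDegree_C_mul_le _ _ |>.trans <| (natDegree_sub_le _ _).trans (max_le ?_ ?_)
    · rw [mul_assoc]
      refine natDegree_C_mul_le _ _ |>.trans <| natDegree_mul_le.trans ?_
      rw [natDegree_X]
      omega
    · exact natDegree_C_mul_le _ _ |>.trans (by omega)

/-- Raising the parameter: `(n + μ) C_n^μ = μ (C_n^{μ+1} - C_{n-2}^{μ+1})`. -/
theorem gegenbauer_eval_raise {m : ℝ} (hm : 0 < m) (x : ℝ) (n : ℕ) :
    ((n : ℝ) + 2 + m) * (gegenbauer m (n + 2)).eval x =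
      m * ((gegenbauer (m + 1) (n + 2)).eval x - (gegenbauer (m + 1) n).eval x) := by
  have h2 := gegenbauer_eval_recurrence m x 0
  have k2 := gegenbauer_eval_recurrence (m + 1) x 0
  have h3 := gegenbauer_eval_recurrence m x 1
  have k3 := gegenbauer_eval_recurrence (m + 1) x 1
  simp only [gegenbauer_eval_zero, gegenbauer_eval_one, zero_add, Nat.reduceAdd, Nat.cast_zero,
    Nat.cast_one] at h2 k2 h3 k3
  induction n using Nat.twoStepInduction with
  | zero =>
    simp only [gegenbauer_eval_zero, zero_add, Nat.cast_zero]
    linear_combination (2 + m) / 2 * h2 - m / 2 * k2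
  | one =>
    simp only [gegenbauer_eval_one, Nat.cast_one, Nat.reduceAdd]
    linear_combination (3 + m) / 3 * h3 - m / 3 * k3 + (3 + m) / 3 * (2 + m) * x * h2
      - m / 3 * (3 + m) * x * k2
  | more n ih0 ih1 =>
    have e1 := gegenbauer_eval_recurrence m x (n + 2)
    have e2 := gegenbauer_eval_recurrence (m + 1) x (n + 2)
    have e3 := gegenbauer_eval_recurrence (m + 1) x n
    simp only [Nat.add_assoc, Nat.reduceAdd] at *
    push_cast at *
    set p4 := (gegenbauer m (n + 4)).eval x
    set p3 := (gegenbauer m (n + 3)).eval x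
    set p2 := (gegenbauer m (n + 2)).eval x
    set c4 := (gegenbauer (m + 1) (n + 4)).eval x
    set c3 := (gegenbauer (m + 1) (n + 3)).eval x
    set c2 := (gegenbauer (m + 1) (n + 2)).eval x
    set c1 := (gegenbauer (m + 1) (n + 1)).eval x
    set c0 := (gegenbauer (m + 1) n).eval x
    have hn : (0 : ℝ) ≤ n := n.cast_nonneg
    -- Every term is rewritten through `c4`, `c2`, `c0`: the recurrence for `m + 1` eliminates the
    -- products `x * c3` and `x * c1`.
    have ih0' : p2 = m * (c2 - c0) / (n + 2 + m) := by
      rw [eq_div_iff (by positivity)]; linear_combination ih0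
    have ih1' : p3 = m * (c3 - c1) / (n + 1 + 2 + m) := by
      rw [eq_div_iff (by positivity)]; linear_combination ih1
    have f3 : x * c3 = ((n + 2 + 2) * c4 + (n + 2 + 2 * (m + 1)) * c2) / (2 * (n + 2 + 1 + (m + 1))) := by
      rw [eq_div_iff (by positivity)]; linear_combination -e2
    have f1 : x * c1 = ((n + 2) * c2 + (n + 2 * (m + 1)) * c0) / (2 * (n + 1 + (m + 1))) := by
      rw [eq_div_iff (by positivity)]; linear_combination -e3
    have e1' : ((n : ℝ) + 2 + 2) * p4 = 2 * m * (x * c3 - x * c1) - (n + 2 + 2 * m) * p2 := by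
      rw [e1, ih1']
      field_simp
      ring
    have : p4 = (2 * m * (x * c3 - x * c1) - (n + 2 + 2 * m) * p2) / (n + 2 + 2) := by
      rw [eq_div_iff (by positivity)]; linear_combination e1'
    rw [this, f3, f1, ih0']
    field_simp
    ring

theorem gegenbauer_eval_lower_index {m : ℝ} (hm : 0 < m) (x : ℝ) (n : ℕ) :
    ((n : ℝ) + 2) * (gegenbauer m (n + 2)).eval x =
      2 * m * (x * (gegenbauer (m + 1) (n + 1)).eval x - (gegenbauer (m + 1) n).eval x) := by
  have h := gegenbauer_eval_raise hm x n
  have e := gegenbauer_eval_recurrence (m + 1) x n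
  have hn : (n : ℝ) + 2 + m ≠ 0 := by positivity
  apply mul_left_cancel₀ hn
  linear_combination (n + 2) * h + m * e

theorem gegenbauer_eval_upper_index {m : ℝ} (hm : 0 < m) (x : ℝ) (n : ℕ) :
    ((n : ℝ) + 1 + 2 * m) * (gegenbauer m (n + 1)).eval x =
      2 * m * ((gegenbauer (m + 1) (n + 1)).eval x - x * (gegenbauer (m + 1) n).eval x) := by
  cases n with
  | zero => simp [gegenbauer_eval_zero, gegenbauer_eval_one]; ring
  | succ n =>
    have h := gegenbauer_eval_raise hm x n
    have e := gegenbauer_eval_lower_index hm x n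
    push_cast
    linear_combination 2 * h - e

theorem derivative_gegenbauer_eval {m : ℝ} (hm : 0 < m) (x : ℝ) (n : ℕ) :
    (derivative (gegenbauer m (n + 1))).eval x = 2 * m * (gegenbauer (m + 1) n).eval x := by
  induction n using Nat.twoStepInduction with
  | zero => simp [gegenbauer_one, gegenbauer_zero]
  | one =>
    have := congrArg (fun p => eval x (derivative p)) (gegenbauer_recurrence m 0)
    simp [gegenbauer_one, gegenbauer_zero] at this
    simp [gegenbauer_one]
    linear_combination this / 2
  | more n ih0 ih1 =>
    have h := congrArg (fun p => eval x (derivative p)) (gegenbauer_recurrence m (n + 1))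
    simp only [Nat.add_assoc, Nat.reduceAdd] at *
    simp only [derivative_mul, derivative_sub, derivative_C, derivative_X, eval_add, eval_sub,
      eval_mul, eval_C, eval_X, zero_mul, zero_add, mul_one, ih0, ih1] at h
    have hr := gegenbauer_eval_raise hm x n
    have e := gegenbauer_eval_recurrence (m + 1) x n
    push_cast at h
    have hn : (n : ℝ) + 3 ≠ 0 := by positivity
    apply mul_left_cancel₀ hn
    linear_combination h + 2 * hr - 2 * m * e

theorem one_sub_sq_mul_derivative_gegenbauer {m : ℝ} (hm : 0 < m) (x : ℝ) (n : ℕ) :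
    (1 - x ^ 2) * (derivative (gegenbauer m (n + 1))).eval x =
      (n + 2 * m) * (gegenbauer m n).eval x - (n + 1) * x * (gegenbauer m (n + 1)).eval x := by
  rw [derivative_gegenbauer_eval hm]
  cases n with
  | zero => simp [gegenbauer_eval_zero, gegenbauer_eval_one]; ring
  | succ n =>
    have h1 := gegenbauer_eval_upper_index hm x n
    have h2 := gegenbauer_eval_lower_index hm x n
    push_cast
    linear_combination - h1 + x * h2

/-- The differential relation behind the Rodrigues formula. -/
theorem gegenbauer_rodrigues_step {m : ℝ} (hm : 0 < m) (x : ℝ) (n : ℕ) :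
    (2 * m) * ((1 - x ^ 2) * (derivative (gegenbauer (m + 1) n)).eval x
      - (2 * m + 1) * x * (gegenbauer (m + 1) n).eval x) =
    -((n + 1) * (n + 1 + 2 * m)) * (gegenbauer m (n + 1)).eval x := by
  cases n with
  | zero => simp [gegenbauer_zero, gegenbauer_one]; ring
  | succ n =>
    have h1 := one_sub_sq_mul_derivative_gegenbauer (m := m + 1) (by linarith) x n
    have h2 := gegenbauer_eval_lower_index hm x n
    push_cast
    linear_combination 2 * m * h1 + (n + 2 + 2 * m) * h2

/-! ### Zeros of the Gegenbauer polynomials. -/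

/-- `C_n^μ` has `n` distinct zeros in `(-1, 1)`; `f` lists them, framed by `f 0 = -1` and
`f (n + 1) = 1`. -/
theorem exists_zeros_gegenbauer (n : ℕ) : ∀ {m : ℝ}, 0 < m → ∃ f : ℕ → ℝ, f 0 = -1 ∧
    f (n + 1) = 1 ∧ (∀ i ≤ n, f i < f (i + 1)) ∧
      ∀ i < n, (gegenbauer m n).eval (f (i + 1)) = 0 := by
  induction n with
  | zero =>
    intro m _
    exact ⟨fun i => if i = 0 then -1 else 1, by simp, by simp, fun i hi => by
      obtain rfl : i = 0 := by omega
      norm_num, by simp⟩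
  | succ n ih =>
    intro m hm
    obtain ⟨f, f0, f1, hf, hz⟩ := ih (m := m + 1) (by linarith)
    have hmono : ∀ j ≤ n + 1, ∀ i ≤ j, f i ≤ f j := by
      intro j hj i hij
      induction j, hij using Nat.le_induction with
      | base => exact le_rfl
      | succ j _ ihj => exact (ihj (by omega)).trans (hf j (by omega)).le
    have hlo : ∀ i ≤ n + 1, -1 ≤ f i := fun i hi => f0 ▸ hmono i hi 0 (by omega)
    have hup : ∀ i ≤ n + 1, f i ≤ 1 := fun i hi => f1 ▸ hmono (n + 1) le_rfl i hi
    -- Rolle's theorem with the Rodrigues relation: `F'` is a nonzero multiple of `(1 - x^2)^(m -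
    -- 1/2) C_{n+1}^m`, and `F` vanishes at `±1` and at the `n` zeros of `C_n^{m+1}`. The induction
    -- therefore lowers the parameter while raising the degree.
    set F : ℝ → ℝ := fun x => (1 - x ^ 2) ^ (m + 1 / 2) * (gegenbauer (m + 1) n).eval x with hF
    have hcont : Continuous F :=
      (Continuous.rpow_const (by fun_prop) fun _ => Or.inr (by linarith)).mul
        (gegenbauer (m + 1) n).continuous
    have hF0 : ∀ i ≤ n + 1, F (f i) = 0 := by
      intro i hi
      rcases i with _ | i
      · simp [hF, f0, Real.zero_rpow (show m + 2⁻¹ ≠ 0 by positivity)]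
      · rcases Nat.lt_or_ge i n with h | h
        · simp [hF, hz i h]
        · obtain rfl : i = n := by omega
          simp [hF, f1, Real.zero_rpow (show m + 2⁻¹ ≠ 0 by positivity)]
    have key : ∀ i, ∃ y, i ≤ n → y ∈ Set.Ioo (f i) (f (i + 1)) ∧
        (gegenbauer m (n + 1)).eval y = 0 := by
      intro i
      by_cases hi : i ≤ n
      swap
      · exact ⟨0, fun h => absurd h hi⟩
      obtain ⟨y, hy, hd⟩ := exists_deriv_eq_zero (hf i hi) hcont.continuousOn
        (by rw [hF0 i (by omega), hF0 (i + 1) (by omega)])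
      refine ⟨y, fun _ => ⟨hy, ?_⟩⟩
      have hy1 : -1 < y := (hlo i (by omega)).trans_lt hy.1
      have hy2 : y < 1 := hy.2.trans_le (hup (i + 1) (by omega))
      have hpos : 0 < 1 - y ^ 2 := by nlinarith
      have hder : HasDerivAt F ((-(2 * y)) * (m + 1 / 2) * (1 - y ^ 2) ^ (m + 1 / 2 - 1)
          * (gegenbauer (m + 1) n).eval y
          + (1 - y ^ 2) ^ (m + 1 / 2) * (derivative (gegenbauer (m + 1) n)).eval y) y := by
        refine HasDerivAt.mul ?_ ((gegenbauer (m + 1) n).hasDerivAt y)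
        refine HasDerivAt.rpow_const (f := fun x => 1 - x ^ 2) ?_ (Or.inl hpos.ne')
        simpa using ((hasDerivAt_id y).pow 2).const_sub 1
      rw [hder.deriv, show m + 1 / 2 = (m + 1 / 2 - 1) + 1 by ring, Real.rpow_add_one hpos.ne',
        show m + 1 / 2 - 1 + 1 - 1 = m + 1 / 2 - 1 by ring] at hd
      have hw : (1 - y ^ 2) ^ (m + 1 / 2 - 1) ≠ 0 := (Real.rpow_pos_of_pos hpos _).ne'
      have hd' : (1 - y ^ 2) * (derivative (gegenbauer (m + 1) n)).eval y
          - (2 * m + 1) * y * (gegenbauer (m + 1) n).eval y = 0 := by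
        apply mul_left_cancel₀ hw
        linear_combination hd
      have hr := gegenbauer_rodrigues_step hm y n
      rw [hd', mul_zero, eq_comm, mul_eq_zero] at hr
      refine hr.resolve_left ?_
      rw [neg_eq_zero]
      positivity
    choose g hg using key
    refine ⟨fun i => if i = 0 then -1 else if i = n + 2 then 1 else g (i - 1), by simp, by simp,
      fun i hi => ?_, fun i hi => ?_⟩
    · rcases i with _ | i
      · simpa [f0] using (hg 0 (by omega)).1.1
      · have h1 := (hg i (by omega)).1
        rcases Nat.lt_or_ge i n with h | h
        · have h2 := (hg (i + 1) (by omega)).1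
          simpa [h.ne, show i ≠ n + 1 by omega] using h1.2.trans h2.1
        · obtain rfl : i = n := by omega
          simpa [f1] using h1.2
    · simpa [show i ≠ n + 1 by omega] using (hg i (by omega)).2

/-! ### Binomial coefficients and the generating function. -/

/-- The Taylor coefficients `(s)_k / k!` of `(1 - x)^{-s}`. -/
noncomputable def risingCoeff (s : ℝ) : ℕ → ℝ
  | 0 => 1
  | k + 1 => (s + k) / (k + 1) * risingCoeff s k

theorem risingCoeff_zero (s : ℝ) : risingCoeff s 0 = 1 := by rw [risingCoeff]

theorem risingCoeff_succ (s : ℝ) (k : ℕ) :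
    ((k : ℝ) + 1) * risingCoeff s (k + 1) = (s + k) * risingCoeff s k := by
  rw [risingCoeff]
  field_simp

theorem risingCoeff_pos {s : ℝ} (hs : 0 < s) (k : ℕ) : 0 < risingCoeff s k := by
  induction k with
  | zero => simp [risingCoeff_zero]
  | succ k ih => rw [risingCoeff]; positivity

theorem gegenbauer_eval_at_one (m : ℝ) (n : ℕ) :
    (gegenbauer m n).eval 1 = risingCoeff (2 * m) n := by
  induction n using Nat.twoStepInduction with
  | zero => simp [gegenbauer_zero, risingCoeff_zero]
  | one => simp [gegenbauer_one, risingCoeff]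
  | more n h0 h1 =>
    have e := gegenbauer_eval_recurrence m 1 n
    have r0 := risingCoeff_succ (2 * m) n
    have r1 := risingCoeff_succ (2 * m) (n + 1)
    rw [h0, h1] at e
    push_cast at r1
    rw [show n + 1 + 1 = n + 2 from rfl] at r1
    have hn : (n : ℝ) + 2 ≠ 0 := by positivity
    apply mul_left_cancel₀ hn
    linear_combination e - r1 + r0

theorem factorial_mul_risingCoeff (s : ℝ) (n : ℕ) :
    (n.factorial : ℝ) * risingCoeff s n = (ascPochhammer ℝ n).eval s := by
  induction n with
  | zero => simp [risingCoeff_zero]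
  | succ n ih =>
    rw [ascPochhammer_succ_eval, ← ih, Nat.factorial_succ]
    push_cast
    linear_combination (n.factorial : ℝ) * risingCoeff_succ s n

theorem choose_eq_risingCoeff (s : ℝ) (n : ℕ) :
    Ring.choose ((s : ℂ) + n - 1) n = (risingCoeff s n : ℂ) := by
  have h1 : Ring.choose (s + n - 1) n = risingCoeff s n := by
    rw [← Ring.multichoose_eq]
    have h := Ring.factorial_nsmul_multichoose_eq_ascPochhammer s n
    rw [ascPochhammer_smeval_eq_eval, ← factorial_mul_risingCoeff, nsmul_eq_mul] at h
    exact mul_left_cancel₀ (by positivity) h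
  rw [← h1, Complex.ofReal_choose]
  push_cast
  rfl

theorem hasSum_risingCoeff (s : ℝ) {v : ℂ} (hv : ‖v‖ < 1) :
    HasSum (fun j => (risingCoeff s j : ℂ) * v ^ j) (1 / (1 - v) ^ (s : ℂ)) := by
  have h := (Complex.one_div_one_sub_cpow_hasFPowerSeriesOnBall_zero (s : ℂ)).hasSum
    (y := v) (by simpa [enorm_eq_nnnorm, ← NNReal.coe_lt_coe] using hv)
  simp only [FormalMultilinearSeries.ofScalars_apply_eq, zero_add] at h
  simpa [choose_eq_risingCoeff] using h

/-- The formal differential equation `(1 - w X) F' = s w F` of `F = (1 - w X)^(-s)`. -/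
theorem derivative_mk_risingCoeff (s : ℝ) (w : ℂ) :
    PowerSeries.derivative ℂ (PowerSeries.mk fun k => (risingCoeff s k : ℂ) * w ^ k) =
      PowerSeries.C w * (PowerSeries.X *
        PowerSeries.derivative ℂ (PowerSeries.mk fun k => (risingCoeff s k : ℂ) * w ^ k)
        + PowerSeries.C (s : ℂ) * PowerSeries.mk fun k => (risingCoeff s k : ℂ) * w ^ k) := by
  ext n
  have h : ((n : ℂ) + 1) * (risingCoeff s (n + 1) : ℂ) = (s + n) * risingCoeff s n := by
    exact_mod_cast congrArg (fun x : ℝ => (x : ℂ)) (risingCoeff_succ s n)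
  rw [PowerSeries.coeff_C_mul, map_add, PowerSeries.coeff_C_mul]
  cases n with
  | zero =>
    simp [PowerSeries.coeff_derivative] at *
    linear_combination w * h
  | succ n =>
    simp only [PowerSeries.coeff_derivative, PowerSeries.coeff_mk, PowerSeries.coeff_succ_X_mul]
    push_cast at *
    linear_combination w ^ (n + 2) * h

/-- The expansion of `C_n^μ((w + w⁻¹) / 2)` in powers of `w`. -/
theorem gegenbauer_joukowski (m : ℝ) {w : ℂ} (hw : w ≠ 0) (n : ℕ) :
    aeval ((w + w⁻¹) / 2) (gegenbauer m n) =
      ∑ p ∈ Finset.HasAntidiagonal.antidiagonal n, (risingCoeff m p.1 * w ^ p.1) * (risingCoeff m p.2 * w⁻¹ ^ p.2) := by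
  set F := PowerSeries.mk fun k => (risingCoeff m k : ℂ) * w ^ k with hF
  set G := PowerSeries.mk fun k => (risingCoeff m k : ℂ) * w⁻¹ ^ k with hG
  have hcoeff : ∀ k, PowerSeries.coeff k (F * G) = ∑ p ∈ Finset.HasAntidiagonal.antidiagonal k,
      (risingCoeff m p.1 * w ^ p.1) * (risingCoeff m p.2 * w⁻¹ ^ p.2) := by
    intro k
    simp [PowerSeries.coeff_mul, hF, hG]
  rw [← hcoeff]
  have dF := derivative_mk_risingCoeff m w
  have dG := derivative_mk_risingCoeff m w⁻¹
  rw [← hF] at dF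
  rw [← hG] at dG
  have hww : PowerSeries.C w * PowerSeries.C w⁻¹ = (1 : PowerSeries ℂ) := by
    rw [← map_mul, mul_inv_cancel₀ hw, map_one]
  have hz : PowerSeries.C ((w + w⁻¹) / 2) * 2 =
      (PowerSeries.C w + PowerSeries.C w⁻¹ : PowerSeries ℂ) := by
    rw [← map_add, show (2 : PowerSeries ℂ) = PowerSeries.C (2 : ℂ) from rfl, ← map_mul]
    congr 1
    ring
  have dH : PowerSeries.derivative ℂ (F * G) = PowerSeries.derivative ℂ F * G + F * PowerSeries.derivative ℂ G := by
    rw [Derivation.leibniz]; simp only [smul_eq_mul]; ring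
  set z := (w + w⁻¹) / 2
  set H := F * G with hH
  -- `H` is formally `(1 - wX)^(-m) (1 - w⁻¹X)^(-m) = (1 - 2zX + X²)^(-m)`, so `(1 - 2zX + X²) H' =
  -- 2m (z - X) H`. Comparing coefficients gives the Gegenbauer recurrence.
  have ode : PowerSeries.derivative ℂ H + PowerSeries.X * (PowerSeries.X * PowerSeries.derivative ℂ H)
      + PowerSeries.C (2 * (m : ℂ)) * (PowerSeries.X * H) =
      PowerSeries.C (2 * z) * (PowerSeries.X * PowerSeries.derivative ℂ H)
        + PowerSeries.C (2 * m * z) * H := by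
    simp only [map_mul, map_ofNat]
    rw [dH, hH]
    set dF' := PowerSeries.derivative ℂ F
    set dG' := PowerSeries.derivative ℂ G
    set x : PowerSeries ℂ := PowerSeries.X
    set a := (PowerSeries.C w : PowerSeries ℂ)
    set b := (PowerSeries.C w⁻¹ : PowerSeries ℂ)
    set u := (PowerSeries.C (m : ℂ) : PowerSeries ℂ)
    linear_combination G * (1 - b * x) * dF + F * (1 - a * x) * dG
      - (x * (dF' * G + F * dG') + u * F * G) * hz
      - (x ^ 2 * (dF' * G + F * dG') + 2 * u * x * F * G) * hww
  induction n using Nat.twoStepInduction with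
  | zero => simp [gegenbauer_zero, hcoeff, risingCoeff_zero]
  | one =>
    have h := congrArg (PowerSeries.coeff 0) ode
    simp only [map_add, PowerSeries.coeff_C_mul, PowerSeries.coeff_zero_X_mul,
      PowerSeries.coeff_derivative, hcoeff 0] at h
    simp [risingCoeff_zero] at h
    rw [gegenbauer_one]
    simp [h]
  | more n h0 h1 =>
    have h := congrArg (PowerSeries.coeff (n + 1)) ode
    have e := gegenbauer_aeval_recurrence m z n
    have hx : PowerSeries.coeff n (PowerSeries.X * PowerSeries.derivative ℂ H) = n * PowerSeries.coeff n H := by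
      cases n with
      | zero => simp
      | succ n =>
        rw [PowerSeries.coeff_succ_X_mul, PowerSeries.coeff_derivative]
        push_cast
        ring
    simp only [map_add, PowerSeries.coeff_C_mul, PowerSeries.coeff_succ_X_mul,
      PowerSeries.coeff_derivative, hx] at h
    rw [h0, h1] at e
    push_cast at h
    rw [show n + 1 + 1 = n + 2 from rfl] at h
    have hn : (n : ℂ) + 2 ≠ 0 := by exact_mod_cast (n + 1).succ_ne_zero
    apply mul_left_cancel₀ hn
    linear_combination e - h

theorem aeval_ofReal_eq (p : ℝ[X]) (x : ℝ) : aeval (x : ℂ) p = ((p.eval x : ℝ) : ℂ) :=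
  Polynomial.aeval_algebraMap_apply_eq_algebraMap_eval x p

/-- For `x = cos θ` the expansion in `w = exp(iθ)` has positive coefficients and unimodular
monomials, so the triangle inequality is an equality at `w = 1`. -/
theorem abs_gegenbauer_eval_le {m : ℝ} (hm : 0 < m) (n : ℕ) {x : ℝ} (hx : x ∈ Set.Icc (-1 : ℝ) 1) :
    |(gegenbauer m n).eval x| ≤ (gegenbauer m n).eval 1 := by
  set w := Complex.exp (Real.arccos x * Complex.I) with hw
  have hw0 : w ≠ 0 := Complex.exp_ne_zero _
  have hwn : ‖w‖ = 1 := Complex.norm_exp_ofReal_mul_I _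
  have hwx : (w + w⁻¹) / 2 = x := by
    rw [hw, ← Complex.exp_neg, ← neg_mul, ← Complex.cos, ← Complex.ofReal_cos,
      Real.cos_arccos hx.1 hx.2]
  have h := gegenbauer_joukowski m hw0 n
  rw [hwx, aeval_ofReal_eq] at h
  have h1 := gegenbauer_joukowski m one_ne_zero n
  rw [show ((1 : ℂ) + 1⁻¹) / 2 = ((1 : ℝ) : ℂ) by norm_num, aeval_ofReal_eq] at h1
  have h1' : (gegenbauer m n).eval 1 =
      ∑ p ∈ Finset.HasAntidiagonal.antidiagonal n, risingCoeff m p.1 * risingCoeff m p.2 := by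
    have : (((gegenbauer m n).eval 1 : ℝ) : ℂ) =
      ((∑ p ∈ Finset.HasAntidiagonal.antidiagonal n, risingCoeff m p.1 * risingCoeff m p.2 : ℝ) : ℂ) := by
      rw [h1]; push_cast; simp
    exact_mod_cast this
  rw [h1', ← Real.norm_eq_abs, ← Complex.norm_real, h]
  refine (norm_sum_le _ _).trans (Finset.sum_le_sum fun p _ => ?_)
  simp [hwn, abs_of_pos (risingCoeff_pos hm _)]

/-! ### Asymptotics of the normalized coefficients. -/

theorem risingCoeff_div_tendsto_one {s : ℝ} (hs : 0 < s) (j : ℕ) :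
    Tendsto (fun k => risingCoeff s k / risingCoeff s (k + j)) atTop (𝓝 1) := by
  induction j with
  | zero => simp [div_self (risingCoeff_pos hs _).ne']
  | succ j ih =>
    have h : Tendsto (fun k : ℕ => 1 + (1 - s) / (((k + j : ℕ) : ℝ) + s)) atTop (𝓝 (1 + 0)) := by
      refine tendsto_const_nhds.add (Tendsto.const_div_atTop ?_ _)
      exact tendsto_atTop_add_const_right _ _
        (tendsto_natCast_atTop_atTop.comp (tendsto_add_atTop_nat j))
    have := ih.mul h
    rw [add_zero, mul_one] at this
    refine this.congr fun k => ?_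
    have e := risingCoeff_succ s (k + j)
    have p1 := risingCoeff_pos hs (k + j)
    have p2 := risingCoeff_pos hs (k + (j + 1))
    rw [← add_assoc] at p2 ⊢
    have p3 : 0 < ((k + j : ℕ) : ℝ) + s := by positivity
    have hA : (1 + (1 - s) / (((k + j : ℕ) : ℝ) + s)) * risingCoeff s (k + j + 1)
        = risingCoeff s (k + j) := by
      field_simp
      linear_combination e
    rw [eq_div_iff p2.ne', mul_assoc, hA, div_mul_cancel₀ _ p1.ne']

/-- For `s < 1` the coefficients themselves decrease; the factor `k` restores monotonicity, because
`(k + 1) r_{k+1} = (s + k) r_k`. -/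
theorem mul_risingCoeff_le {s : ℝ} (hs : 0 < s) {i k : ℕ} (h : i ≤ k) :
    i * risingCoeff s i ≤ k * risingCoeff s k := by
  induction k, h using Nat.le_induction with
  | base => exact le_rfl
  | succ k _ ih =>
    refine ih.trans ?_
    push_cast
    rw [risingCoeff_succ]
    exact mul_le_mul_of_nonneg_right (by linarith) (risingCoeff_pos hs k).le

/-- A bound uniform in `i` and linear in `j`, which supplies the summable majorant for dominated
convergence. -/
theorem risingCoeff_div_le {s : ℝ} (hs : 0 < s) (i j : ℕ) :
    risingCoeff s i / risingCoeff s (i + j) ≤ (1 + j) * (1 + 1 / s) := by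
  rw [div_le_iff₀ (risingCoeff_pos hs _)]
  have hp := risingCoeff_pos hs (i + j)
  rcases Nat.eq_zero_or_pos i with rfl | hi
  · rw [risingCoeff_zero, zero_add]
    rcases Nat.eq_zero_or_pos j with rfl | hj
    · simp [risingCoeff_zero, hs.le]
    · have h := mul_risingCoeff_le hs hj
      have h1 : risingCoeff s 1 = s := by simp [risingCoeff]
      rw [h1, Nat.cast_one, one_mul] at h
      rw [zero_add] at hp
      have h2 : 1 ≤ 1 / s * (j * risingCoeff s j) := by
        rw [one_div, ← div_eq_inv_mul, le_div_iff₀ hs]; linarith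
      have h3 : 0 < 1 / s := by positivity
      have h4 : (0 : ℝ) ≤ j := j.cast_nonneg
      nlinarith [mul_pos h3 hp, mul_nonneg h4 hp.le]
  · have h := mul_risingCoeff_le hs (Nat.le_add_right i j)
    have hi' : (1 : ℝ) ≤ i := by exact_mod_cast hi
    have h3 : 0 < 1 / s := by positivity
    have h4 : (0 : ℝ) ≤ j := j.cast_nonneg
    have h5 : (i : ℝ) * risingCoeff s i ≤ i * ((1 + j) * risingCoeff s (i + j)) := by
      refine h.trans ?_
      rw [← mul_assoc]
      push_cast
      exact mul_le_mul_of_nonneg_right (by nlinarith) hp.le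
    have h6 := le_of_mul_le_mul_left h5 (by linarith)
    refine h6.trans ?_
    rw [mul_assoc]
    refine mul_le_mul_of_nonneg_left ?_ (by positivity)
    nlinarith [mul_pos h3 hp]

theorem summable_mul_risingCoeff {s r : ℝ} (hs : 0 < s) (hr0 : 0 < r) (hr : r < 1) :
    Summable fun j : ℕ => (1 + j) * risingCoeff s j * r ^ j := by
  have hpos : ∀ j : ℕ, 0 < (1 + j) * risingCoeff s j * r ^ j := fun j => by
    have := risingCoeff_pos hs j
    positivity
  refine summable_of_ratio_test_tendsto_lt_one hr (Eventually.of_forall fun j => (hpos j).ne') ?_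
  have h1 : Tendsto (fun j : ℕ => (1 + 1 / ((j : ℝ) + 1)) * (1 + (s - 1) / ((j : ℝ) + 1)) * r) atTop
      (𝓝 ((1 + 0) * (1 + 0) * r)) := by
    have : Tendsto (fun j : ℕ => (j : ℝ) + 1) atTop atTop :=
      tendsto_atTop_add_const_right _ _ tendsto_natCast_atTop_atTop
    exact ((tendsto_const_nhds.add (this.const_div_atTop _)).mul
      (tendsto_const_nhds.add (this.const_div_atTop _))).mul_const r
  simp only [add_zero, one_mul] at h1
  refine h1.congr fun j => ?_
  rw [Real.norm_of_nonneg (hpos _).le, Real.norm_of_nonneg (hpos _).le, risingCoeff]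
  have := risingCoeff_pos hs j
  push_cast
  field_simp
  ring

/-- The normalized coefficients of `C_k^s((w + w⁻¹) / 2) / w ^ k` as a polynomial in `w⁻²`. -/
noncomputable def normalizedCoeff (s : ℝ) (k j : ℕ) : ℝ :=
  if j ≤ k then risingCoeff s j * (risingCoeff s (k - j) / risingCoeff s k) else 0

theorem normalizedCoeff_nonneg {s : ℝ} (hs : 0 < s) (k j : ℕ) : 0 ≤ normalizedCoeff s k j := by
  rw [normalizedCoeff]
  split_ifs
  · have := risingCoeff_pos hs
    exact mul_nonneg (this _).le (div_nonneg (this _).le (this _).le)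
  · exact le_rfl

theorem normalizedCoeff_le {s : ℝ} (hs : 0 < s) (k j : ℕ) :
    normalizedCoeff s k j ≤ (1 + 1 / s) * ((1 + j) * risingCoeff s j) := by
  have hj := risingCoeff_pos hs j
  rw [normalizedCoeff]
  split_ifs with h
  · have := risingCoeff_div_le hs (k - j) j
    rw [Nat.sub_add_cancel h] at this
    calc _ ≤ risingCoeff s j * ((1 + j) * (1 + 1 / s)) := mul_le_mul_of_nonneg_left this hj.le
      _ = _ := by ring
  · positivity

theorem tendsto_normalizedCoeff {s : ℝ} (hs : 0 < s) (j : ℕ) :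
    Tendsto (fun k => normalizedCoeff s k j) atTop (𝓝 (risingCoeff s j)) := by
  rw [← tendsto_add_atTop_iff_nat j]
  have := (risingCoeff_div_tendsto_one hs j).const_mul (risingCoeff s j)
  rw [mul_one] at this
  refine this.congr fun k => ?_
  simp [normalizedCoeff]

theorem abs_normalizedCoeff_sub_le {s : ℝ} (hs : 0 < s) (k j : ℕ) :
    |normalizedCoeff s k j - risingCoeff s j| ≤ (1 + 1 / s) * ((1 + j) * risingCoeff s j) := by
  have h1 := normalizedCoeff_nonneg hs k j
  have h2 := normalizedCoeff_le hs k j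
  have h3 := risingCoeff_pos hs j
  have h4 : (0 : ℝ) ≤ j := j.cast_nonneg
  have h5 : 0 < 1 / s := by positivity
  have h6 : risingCoeff s j ≤ (1 + 1 / s) * ((1 + j) * risingCoeff s j) := by
    rw [← mul_assoc]
    exact le_mul_of_one_le_left h3.le (by nlinarith [mul_nonneg h4 h5.le])
  rw [abs_le]
  constructor <;> linarith

/-- Dominated convergence for series. The weight `r ^ j` makes the resulting estimate uniform over
the circle `‖v‖ = r`. -/
theorem tendsto_tsum_abs_normalizedCoeff_sub {s r : ℝ} (hs : 0 < s) (hr0 : 0 < r) (hr : r < 1) :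
    Tendsto (fun k => ∑' j, |normalizedCoeff s k j - risingCoeff s j| * r ^ j) atTop (𝓝 0) := by
  have hsum := (summable_mul_risingCoeff hs hr0 hr).mul_left (1 + 1 / s)
  have := tendsto_tsum_of_dominated_convergence (𝓕 := atTop)
    (f := fun k j => |normalizedCoeff s k j - risingCoeff s j| * r ^ j) (g := fun _ => (0 : ℝ)) hsum
    (fun j => by
      have h := (((tendsto_normalizedCoeff hs j).sub_const (risingCoeff s j)).abs).mul_const (r ^ j)
      simpa using h)
    (Eventually.of_forall fun k j => by
      rw [Real.norm_of_nonneg (by positivity)]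
      calc _ ≤ (1 + 1 / s) * ((1 + j) * risingCoeff s j) * r ^ j :=
            mul_le_mul_of_nonneg_right (abs_normalizedCoeff_sub_le hs k j) (by positivity)
        _ = _ := by ring)
  simpa using this

theorem gegenbauer_joukowski_normalized {s : ℝ} (hs : 0 < s) {w : ℂ} (hw : w ≠ 0) (k : ℕ) :
    aeval ((w + w⁻¹) / 2) (gegenbauer s k) = risingCoeff s k * w ^ k *
      ∑ j ∈ Finset.range (k + 1), (normalizedCoeff s k j : ℂ) * ((w ^ 2)⁻¹) ^ j := by
  rw [gegenbauer_joukowski s hw, ← Finset.Nat.sum_antidiagonal_eq_sum_range_succ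
    (fun j _ => (normalizedCoeff s k j : ℂ) * ((w ^ 2)⁻¹) ^ j), Finset.mul_sum, ← Finset.Nat.sum_antidiagonal_swap]
  refine Finset.sum_congr rfl fun p hp => ?_
  have hk : p.1 + p.2 = k := Finset.HasAntidiagonal.mem_antidiagonal.mp hp
  have hne : (risingCoeff s k : ℂ) ≠ 0 := by exact_mod_cast (risingCoeff_pos hs k).ne'
  rw [normalizedCoeff, if_pos (by omega), show k - p.1 = p.2 by omega]
  have hwk : w ^ k = w ^ p.1 * w ^ p.2 := by rw [← pow_add, hk]
  rw [hwk]
  push_cast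
  simp only [Prod.fst_swap, Prod.snd_swap, inv_pow]
  field_simp
  ring

/-- The sum is a perturbation of `(1 - v)^(-s)`, whose modulus is at least `(1 + r)^(-s)` since `|1
- v| ≤ 1 + r`. -/
theorem norm_sum_normalizedCoeff_ge {s r : ℝ} (hs : 0 < s) (hr0 : 0 < r) (hr : r < 1) (k : ℕ) {v : ℂ}
    (hv : ‖v‖ = r) :
    (1 + r) ^ (-s) - ∑' j, |normalizedCoeff s k j - risingCoeff s j| * r ^ j ≤
      ‖∑ j ∈ Finset.range (k + 1), (normalizedCoeff s k j : ℂ) * v ^ j‖ := by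
  have h1 := hasSum_risingCoeff s (v := v) (by rw [hv]; exact hr)
  have h2 : HasSum (fun j => (normalizedCoeff s k j : ℂ) * v ^ j)
      (∑ j ∈ Finset.range (k + 1), (normalizedCoeff s k j : ℂ) * v ^ j) :=
    hasSum_sum_of_ne_finset_zero fun j hj => by
      rw [normalizedCoeff, if_neg (by simpa using hj)]; simp
  have h3 := h2.sub h1
  have hsum : Summable fun j => |normalizedCoeff s k j - risingCoeff s j| * r ^ j := by
    refine Summable.of_nonneg_of_le (fun j => by positivity) (fun j => ?_)
      ((summable_mul_risingCoeff hs hr0 hr).mul_left (1 + 1 / s))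
    calc _ ≤ (1 + 1 / s) * ((1 + j) * risingCoeff s j) * r ^ j :=
            mul_le_mul_of_nonneg_right (abs_normalizedCoeff_sub_le hs k j) (by positivity)
      _ = _ := by ring
  have h4 := h3.norm_le_of_bounded hsum.hasSum fun j => by
    rw [← sub_mul, norm_mul, norm_pow, hv, ← Complex.ofReal_sub, Complex.norm_real, Real.norm_eq_abs]
  have h5 : (1 + r) ^ (-s) ≤ ‖1 / (1 - v) ^ (s : ℂ)‖ := by
    have hv1 : 1 - v ≠ 0 := by
      intro h
      rw [sub_eq_zero] at h
      rw [← h, norm_one] at hv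
      linarith
    have h1r : ‖1 - v‖ ≤ 1 + r := (norm_sub_le _ _).trans (by rw [norm_one, hv])
    rw [norm_div, norm_one, Complex.norm_cpow_real, Real.rpow_neg (by linarith), one_div]
    exact inv_anti₀ (Real.rpow_pos_of_pos (norm_pos_iff.mpr hv1) _)
      (Real.rpow_le_rpow (norm_nonneg _) h1r hs.le)
  have h6 := norm_sub_norm_le (1 / (1 - v) ^ (s : ℂ))
    (∑ j ∈ Finset.range (k + 1), (normalizedCoeff s k j : ℂ) * v ^ j)
  rw [norm_sub_rev] at h6
  linarith

/-! ### Lower bounds on the ellipse. -/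

theorem exists_unit_joukowski_sub {t : ℝ} (ht : t ∈ Set.Icc (-1 : ℝ) 1) :
    ∃ a : ℂ, ‖a‖ = 1 ∧ ∀ w : ℂ, w ≠ 0 → (w + w⁻¹) / 2 - t = (w - a) * (w - a⁻¹) / (2 * w) := by
  set a := Complex.exp (Real.arccos t * Complex.I) with ha
  have ha0 : a ≠ 0 := Complex.exp_ne_zero _
  have hax : (t : ℂ) = (a + a⁻¹) / 2 := by
    rw [ha, ← Complex.exp_neg, ← neg_mul, ← Complex.cos, ← Complex.ofReal_cos,
      Real.cos_arccos ht.1 ht.2]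
  refine ⟨a, Complex.norm_exp_ofReal_mul_I _, fun w hw => ?_⟩
  rw [hax]
  field_simp
  ring

theorem norm_joukowski_sub_ge {t : ℝ} (ht : t ∈ Set.Icc (-1 : ℝ) 1) {ρ : ℝ} (hρ : 1 < ρ) {w : ℂ}
    (hw : ‖w‖ = ρ) : (ρ - 1) ^ 2 / (2 * ρ) ≤ ‖(w + w⁻¹) / 2 - t‖ := by
  obtain ⟨a, ha, h⟩ := exists_unit_joukowski_sub ht
  have hw0 : w ≠ 0 := by rw [← norm_pos_iff]; linarith
  have h1 := norm_sub_norm_le w a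
  have h2 := norm_sub_norm_le w a⁻¹
  rw [hw, ha] at h1
  rw [hw, norm_inv, ha, inv_one] at h2
  rw [h w hw0, norm_div, norm_mul, norm_mul, hw, Complex.norm_two, sq]
  gcongr

theorem joukowski_sub_ne_zero {t : ℝ} (ht : t ∈ Set.Icc (-1 : ℝ) 1) {w : ℂ} (hw : 1 < ‖w‖) :
    (w + w⁻¹) / 2 - t ≠ 0 := by
  rw [← norm_pos_iff]
  refine lt_of_lt_of_le ?_ (norm_joukowski_sub_ge ht hw rfl)
  have : 0 < ‖w‖ - 1 := by linarith
  positivity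

theorem norm_one_sub_joukowski_sq_ge {ρ : ℝ} (hρ : 1 < ρ) {w : ℂ} (hw : ‖w‖ = ρ) :
    (ρ - ρ⁻¹) ^ 2 / 4 ≤ ‖1 - ((w + w⁻¹) / 2) ^ 2‖ := by
  have hw0 : w ≠ 0 := by rw [← norm_pos_iff]; linarith
  have h : 1 - ((w + w⁻¹) / 2) ^ 2 = -((w - w⁻¹) ^ 2 / 4) := by
    field_simp
    ring
  have h1 := norm_sub_norm_le w w⁻¹
  rw [hw, norm_inv, hw] at h1
  have h2 : ρ⁻¹ < ρ := (inv_lt_one_of_one_lt₀ hρ).trans hρ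
  rw [h, norm_neg, norm_div, norm_pow]
  have : ‖(4 : ℂ)‖ = 4 := by simp
  rw [this]
  gcongr

theorem roots_eq_of_card_ge {p : ℝ[X]} (hp : p ≠ 0) {s : Finset ℝ} (hs : p.natDegree ≤ s.card)
    (h : ∀ t ∈ s, p.eval t = 0) : p.roots = s.val := by
  have hle : s.val ≤ p.roots := by
    rw [Multiset.le_iff_subset s.nodup]
    intro t ht
    exact (mem_roots hp).mpr (h t ht)
  exact (Multiset.eq_of_le_of_card_le hle ((card_roots' p).trans hs)).symm

theorem aeval_eq_prod_of_card_ge {p : ℝ[X]} (hp : p ≠ 0) {s : Finset ℝ} (hs : p.natDegree ≤ s.card)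
    (h : ∀ t ∈ s, p.eval t = 0) (z : ℂ) :
    aeval z p = p.leadingCoeff * ∏ t ∈ s, (z - t) := by
  have hr := roots_eq_of_card_ge hp hs h
  have hc : p.roots.card = p.natDegree :=
    le_antisymm (card_roots' p) (by rw [hr]; exact hs)
  have := C_leadingCoeff_mul_prod_multiset_X_sub_C hc
  rw [hr] at this
  conv_lhs => rw [← this]
  rw [map_mul, aeval_C, map_multiset_prod, Multiset.map_map]
  simp

/-- The zeros of `C_n^μ`, as a set of `n` points of `(-1, 1)`. -/
theorem exists_zero_finset_gegenbauer {m : ℝ} (hm : 0 < m) (n : ℕ) : ∃ s : Finset ℝ,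
    s.card = n ∧ ∀ t ∈ s, t ∈ Set.Ioo (-1 : ℝ) 1 ∧ (gegenbauer m n).eval t = 0 := by
  obtain ⟨f, f0, f1, hf, hz⟩ := exists_zeros_gegenbauer n hm
  have hlt : ∀ j ≤ n + 1, ∀ i < j, f i < f j := by
    intro j hj i hij
    induction j, hij using Nat.le_induction with
    | base => exact hf i (by omega)
    | succ j _ ihj => exact (ihj (by omega)).trans (hf j (by omega))
  refine ⟨(Finset.range n).image fun i => f (i + 1), ?_, ?_⟩
  · rw [Finset.card_image_of_injOn, Finset.card_range]
    intro i hi j hj hij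
    simp only [Finset.coe_range, Set.mem_Iio] at hi hj
    by_contra hne
    rcases Nat.lt_or_gt_of_ne hne with h | h
    · exact (hlt (j + 1) (by omega) (i + 1) (by omega)).ne hij
    · exact (hlt (i + 1) (by omega) (j + 1) (by omega)).ne' hij
  · intro t ht
    obtain ⟨i, hi, rfl⟩ := Finset.mem_image.mp ht
    rw [Finset.mem_range] at hi
    exact ⟨⟨f0 ▸ hlt (i + 1) (by omega) 0 (by omega), f1 ▸ hlt (n + 1) le_rfl (i + 1) (by omega)⟩,
      hz i hi⟩

theorem gegenbauer_eval_one_pos {m : ℝ} (hm : 0 < m) (n : ℕ) : 0 < (gegenbauer m n).eval 1 := by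
  rw [gegenbauer_eval_at_one]
  exact risingCoeff_pos (by linarith) n

theorem gegenbauer_ne_zero {m : ℝ} (hm : 0 < m) (n : ℕ) : gegenbauer m n ≠ 0 := by
  intro h
  have := gegenbauer_eval_one_pos hm n
  simp [h] at this

theorem gegenbauer_joukowski_ne_zero {m : ℝ} (hm : 0 < m) (n : ℕ) {w : ℂ} (hw : 1 < ‖w‖) :
    aeval ((w + w⁻¹) / 2) (gegenbauer m n) ≠ 0 := by
  obtain ⟨s, hc, hs⟩ := exists_zero_finset_gegenbauer hm n
  rw [aeval_eq_prod_of_card_ge (gegenbauer_ne_zero hm n) (hc ▸ natDegree_gegenbauer_le m n)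
    fun t ht => (hs t ht).2]
  refine mul_ne_zero ?_ (Finset.prod_ne_zero_iff.mpr fun t ht => ?_)
  · exact_mod_cast leadingCoeff_ne_zero.mpr (gegenbauer_ne_zero hm n)
  · exact joukowski_sub_ne_zero (Set.Ioo_subset_Icc_self (hs t ht).1) hw

/-- Compactness gives a positive bound for each single `k`; it serves those `k` for which the
asymptotic estimate is not yet positive. -/
theorem exists_pos_le_norm_gegenbauer_joukowski {m ρ : ℝ} (hm : 0 < m) (hρ : 1 < ρ) (k : ℕ) :
    ∃ b : ℝ, 0 < b ∧ ∀ w : ℂ, ‖w‖ = ρ → b ≤ ‖aeval ((w + w⁻¹) / 2) (gegenbauer m k)‖ := by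
  have hcomp : IsCompact (Metric.sphere (0 : ℂ) ρ) := isCompact_sphere 0 ρ
  have hcont : ContinuousOn (fun w : ℂ => ‖aeval ((w + w⁻¹) / 2) (gegenbauer m k)‖)
      (Metric.sphere (0 : ℂ) ρ) := by
    refine ContinuousOn.norm ?_
    refine (Polynomial.continuous_aeval (gegenbauer m k)).comp_continuousOn ?_
    refine ContinuousOn.div_const (continuousOn_id.add (continuousOn_id.inv₀ ?_)) 2
    intro w hw
    have : ‖w‖ = ρ := by simpa using hw
    rw [id, ← norm_pos_iff]
    linarith
  obtain ⟨w0, hw0, hmin⟩ := hcomp.exists_isMinOn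
    (NormedSpace.sphere_nonempty.mpr (by linarith)) hcont
  have hw0' : ‖w0‖ = ρ := by simpa using hw0
  exact ⟨_, norm_pos_iff.mpr (gegenbauer_joukowski_ne_zero hm k (hw0' ▸ hρ)),
    fun w hw => hmin (by simpa using hw)⟩

/-- A sharp uniform lower bound of `C_k^μ` on the Bernstein ellipse. -/
theorem exists_lower_bound_gegenbauer {m ρ : ℝ} (hm : 0 < m) (hρ : 1 < ρ) :
    ∃ L : ℕ → ℝ, (∀ k, 0 < L k) ∧ Tendsto L atTop (𝓝 ((1 + (ρ ^ 2)⁻¹) ^ (-m))) ∧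
      ∀ (k : ℕ) (w : ℂ), ‖w‖ = ρ →
        risingCoeff m k * ρ ^ k * L k ≤ ‖aeval ((w + w⁻¹) / 2) (gegenbauer m k)‖ := by
  have hρ0 : 0 < ρ := by linarith
  set r := (ρ ^ 2)⁻¹ with hr
  have hr0 : 0 < r := by positivity
  have hr1 : r < 1 := inv_lt_one_of_one_lt₀ (one_lt_pow₀ hρ two_ne_zero)
  set B := (1 + r) ^ (-m) with hB
  have hBpos : 0 < B := Real.rpow_pos_of_pos (by linarith) _
  set δ : ℕ → ℝ := fun k => ∑' j, |normalizedCoeff m k j - risingCoeff m j| * r ^ j with hδ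
  have hlim : Tendsto δ atTop (𝓝 0) := tendsto_tsum_abs_normalizedCoeff_sub hm hr0 hr1
  choose b hb hbw using fun k => exists_pos_le_norm_gegenbauer_joukowski hm hρ k
  have hpos : ∀ k, 0 < risingCoeff m k * ρ ^ k := fun k =>
    mul_pos (risingCoeff_pos hm k) (by positivity)
  -- Eventually `δ k < B`, so only the first branch affects the limit; the second keeps `L` positive
  -- for all `k`.
  refine ⟨fun k => if δ k < B then B - δ k else b k / (risingCoeff m k * ρ ^ k), fun k => ?_, ?_,
    fun k w hw => ?_⟩
  · dsimp only
    split_ifs with h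
    · linarith
    · exact div_pos (hb k) (hpos k)
  · have : Tendsto (fun k => B - δ k) atTop (𝓝 (B - 0)) := hlim.const_sub B
    rw [sub_zero] at this
    refine this.congr' ?_
    filter_upwards [hlim.eventually_lt_const hBpos] with k hk
    rw [if_pos hk]
  · dsimp only
    split_ifs with h
    · have hw0 : w ≠ 0 := by rw [← norm_pos_iff]; linarith
      rw [gegenbauer_joukowski_normalized hm hw0, norm_mul, norm_mul, norm_pow, hw,
        Complex.norm_real, Real.norm_of_nonneg (risingCoeff_pos hm k).le]
      refine mul_le_mul_of_nonneg_left ?_ (hpos k).le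
      exact norm_sum_normalizedCoeff_ge hm hr0 hr1 k (by rw [norm_inv, norm_pow, hw])
    · rw [mul_div_cancel₀ _ (hpos k).ne']
      exact hbw k w hw

/-! ### Geometry of the elliptic region. -/

/-- The two distances are `|w ∓ 1|² / (2|w|)`, and the parallelogram law adds them. -/
theorem norm_joukowski_foci {w : ℂ} (hw : w ≠ 0) :
    ‖(w + w⁻¹) / 2 - 1‖ + ‖(w + w⁻¹) / 2 + 1‖ = ‖w‖ + ‖w‖⁻¹ := by
  have h1 : (w + w⁻¹) / 2 - 1 = (w - 1) ^ 2 / (2 * w) := by field_simp; ring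
  have h2 : (w + w⁻¹) / 2 + 1 = (w + 1) ^ 2 / (2 * w) := by field_simp; ring
  have hn : ‖w‖ ≠ 0 := norm_ne_zero_iff.mpr hw
  have hp := parallelogram_law_with_norm ℝ w 1
  rw [norm_one] at hp
  rw [h1, h2, norm_div, norm_div, norm_pow, norm_pow, norm_mul, Complex.norm_two]
  field_simp
  linear_combination hp

theorem joukowski_mem_bernsteinRegion {ρ : ℝ} {w : ℂ} (h1 : 1 ≤ ‖w‖) (h2 : ‖w‖ ≤ ρ) :
    (w + w⁻¹) / 2 ∈ bernsteinRegion ρ := by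
  have hw : w ≠ 0 := by rw [← norm_pos_iff]; linarith
  have h0 : 0 < ‖w‖ := by linarith
  rw [bernsteinRegion, Set.mem_ofPred_eq, norm_joukowski_foci hw]
  have hr : 0 < ρ := by linarith
  have : 0 ≤ (ρ - ‖w‖) * (ρ * ‖w‖ - 1) / (ρ * ‖w‖) :=
    div_nonneg (mul_nonneg (by linarith) (by nlinarith)) (by positivity)
  have e : (ρ - ‖w‖) * (ρ * ‖w‖ - 1) / (ρ * ‖w‖) = ρ + ρ⁻¹ - (‖w‖ + ‖w‖⁻¹) := by
    field_simp
    ring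
  linarith

theorem bernsteinRegion_mem_nhds {ρ : ℝ} {z : ℂ} (h : ‖z - 1‖ + ‖z + 1‖ < ρ + ρ⁻¹) :
    bernsteinRegion ρ ∈ 𝓝 z := by
  have hopen : IsOpen {z : ℂ | ‖z - 1‖ + ‖z + 1‖ < ρ + ρ⁻¹} :=
    isOpen_lt (by fun_prop) continuous_const
  exact mem_of_superset (hopen.mem_nhds h) fun y (hy : _ < _) => show _ ≤ ρ + ρ⁻¹ from hy.le

theorem bernsteinRegion_mem_nhds_joukowski {ρ : ℝ} {w : ℂ} (h1 : 1 < ‖w‖) (h2 : ‖w‖ < ρ) :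
    bernsteinRegion ρ ∈ 𝓝 ((w + w⁻¹) / 2) := by
  have hw : w ≠ 0 := by rw [← norm_pos_iff]; linarith
  have h0 : 0 < ‖w‖ := by linarith
  refine bernsteinRegion_mem_nhds ?_
  rw [norm_joukowski_foci hw]
  have hr : 0 < ρ := by linarith
  have : 0 < (ρ - ‖w‖) * (ρ * ‖w‖ - 1) / (ρ * ‖w‖) :=
    div_pos (mul_pos (by linarith) (by nlinarith)) (by positivity)
  have e : (ρ - ‖w‖) * (ρ * ‖w‖ - 1) / (ρ * ‖w‖) = ρ + ρ⁻¹ - (‖w‖ + ‖w‖⁻¹) := by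
    field_simp
    ring
  linarith

theorem bernsteinRegion_mem_nhds_ofReal {ρ : ℝ} (hρ : 1 < ρ) {t : ℝ} (ht : t ∈ Set.Icc (-1 : ℝ) 1) :
    bernsteinRegion ρ ∈ 𝓝 (t : ℂ) := by
  refine bernsteinRegion_mem_nhds ?_
  have e1 : ‖(t : ℂ) - 1‖ = 1 - t := by
    rw [← Complex.ofReal_one, ← Complex.ofReal_sub, Complex.norm_real, Real.norm_eq_abs,
      abs_of_nonpos (by linarith [ht.2])]
    ring
  have e2 : ‖(t : ℂ) + 1‖ = t + 1 := by
    rw [← Complex.ofReal_one, ← Complex.ofReal_add, Complex.norm_real, Real.norm_eq_abs,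
      abs_of_nonneg (by linarith [ht.1])]
  rw [e1, e2]
  have : 0 < (ρ - 1) ^ 2 / ρ := div_pos (pow_pos (by linarith) 2) (by linarith)
  have e : (ρ - 1) ^ 2 / ρ = ρ + ρ⁻¹ - 2 := by
    field_simp
    ring
  linarith

theorem bernsteinEllipse_eq_image (ρ : ℝ) :
    bernsteinEllipse ρ = (fun w : ℂ => (w + w⁻¹) / 2) '' Metric.sphere 0 ρ := by
  ext z
  simp [bernsteinEllipse, eq_comm]

theorem continuousOn_joukowski {ρ : ℝ} (hρ : 1 < ρ) :
    ContinuousOn (fun w : ℂ => (w + w⁻¹) / 2) (Metric.sphere 0 ρ) := by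
  refine ContinuousOn.div_const (continuousOn_id.add (continuousOn_id.inv₀ ?_)) 2
  intro w hw
  have : ‖w‖ = ρ := by simpa using hw
  rw [id, ← norm_pos_iff]
  linarith

theorem norm_le_maxOnEllipse {ρ : ℝ} (hρ : 1 < ρ) {u : ℂ → ℂ}
    (hu : ContinuousOn u (bernsteinEllipse ρ)) {z : ℂ} (hz : z ∈ bernsteinEllipse ρ) :
    ‖u z‖ ≤ maxOnEllipse ρ u := by
  have hc : IsCompact (bernsteinEllipse ρ) := by
    rw [bernsteinEllipse_eq_image]
    exact (isCompact_sphere 0 ρ).image_of_continuousOn (continuousOn_joukowski hρ)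
  exact le_csSup (hc.image_of_continuousOn hu.norm).bddAbove ⟨z, hz, rfl⟩

theorem bernsteinEllipse_subset_bernsteinRegion {ρ : ℝ} (hρ : 1 < ρ) :
    bernsteinEllipse ρ ⊆ bernsteinRegion ρ := by
  rintro z ⟨w, hw, rfl⟩
  exact joukowski_mem_bernsteinRegion (by linarith) hw.le

/-! ### Contour integration on the ellipse. -/

/-- The integral of `g` along the Bernstein ellipse, pulled back to the circle of radius `ρ`. -/
noncomputable def ellipseIntegral (ρ : ℝ) (g : ℂ → ℂ) : ℂ :=
  ∮ w in C(0, ρ), g ((w + w⁻¹) / 2) * ((1 - (w ^ 2)⁻¹) / 2)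

theorem circleIntegrable_joukowski {ρ : ℝ} (hρ : 1 < ρ) {g : ℂ → ℂ}
    (hg : ContinuousOn g (bernsteinEllipse ρ)) :
    CircleIntegrable (fun w => g ((w + w⁻¹) / 2) * ((1 - (w ^ 2)⁻¹) / 2)) 0 ρ := by
  refine ContinuousOn.circleIntegrable (by linarith) (ContinuousOn.mul ?_ ?_)
  · refine hg.comp (continuousOn_joukowski hρ) ?_
    rw [bernsteinEllipse_eq_image]
    exact Set.mapsTo_image _ _
  · refine ContinuousOn.div_const (continuousOn_const.sub ((continuousOn_id.pow 2).inv₀ ?_)) 2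
    intro w hw
    have : ‖w‖ = ρ := by simpa using hw
    have : w ≠ 0 := by rw [← norm_pos_iff]; linarith
    simpa using this

/-- The unit circle maps onto `[-1, 1]` traversed twice in opposite directions: `θ ↦ 2π - θ`
preserves `z` and reverses `dz`. No regularity of `g` is involved. -/
theorem circleIntegral_joukowski_one (g : ℂ → ℂ) :
    (∮ w in C(0, 1), g ((w + w⁻¹) / 2) * ((1 - (w ^ 2)⁻¹) / 2)) = 0 := by
  rw [circleIntegral]
  set h : ℝ → ℂ := fun θ => deriv (circleMap 0 1) θ •
    (g ((circleMap 0 1 θ + (circleMap 0 1 θ)⁻¹) / 2) * ((1 - (circleMap 0 1 θ ^ 2)⁻¹) / 2)) with hh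
  have hsymm : ∀ θ, h (2 * Real.pi - θ) = - h θ := by
    intro θ
    have hc : circleMap 0 1 (2 * Real.pi - θ) = (circleMap 0 1 θ)⁻¹ := by
      simp only [circleMap, zero_add, Complex.ofReal_one, one_mul, ← Complex.exp_neg]
      push_cast
      rw [sub_mul, Complex.exp_sub, Complex.exp_two_pi_mul_I, Complex.exp_neg, one_div]
    have hne : circleMap 0 1 θ ≠ 0 := circleMap_ne_center one_ne_zero
    simp only [hh, deriv_circleMap, hc, smul_eq_mul, inv_inv, add_comm (circleMap 0 1 θ)⁻¹]
    field_simp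
    ring
  have hi := intervalIntegral.integral_comp_sub_left (a := 0) (b := 2 * Real.pi) h (2 * Real.pi)
  simp only [hsymm, sub_self, sub_zero, intervalIntegral.integral_neg] at hi
  linear_combination -(1 / 2 : ℂ) * hi

/-- The pulled-back integrand is holomorphic in the annulus `1 < |w| < ρ`, so the contour shrinks to
the unit circle, where the integral cancels. -/
theorem ellipseIntegral_eq_zero {ρ : ℝ} (hρ : 1 < ρ) {g : ℂ → ℂ}
    (hg : DifferentiableOn ℂ g (bernsteinRegion ρ)) : ellipseIntegral ρ g = 0 := by
  refine Eq.trans ?_ (circleIntegral_joukowski_one g)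
  refine Complex.circleIntegral_eq_of_differentiable_on_annulus_off_countable one_pos hρ.le
    Set.countable_empty ?_ ?_
  · have hne : ∀ w ∈ Metric.closedBall (0 : ℂ) ρ \ Metric.ball 0 1, w ≠ 0 := by
      intro w hw
      have : 1 ≤ ‖w‖ := by simpa using hw.2
      rw [← norm_pos_iff]
      linarith
    refine ContinuousOn.mul (hg.continuousOn.comp ?_ ?_) ?_
    · exact ContinuousOn.div_const (continuousOn_id.add (continuousOn_id.inv₀ hne)) 2
    · intro w hw
      exact joukowski_mem_bernsteinRegion (by simpa using hw.2) (by simpa using hw.1)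
    · refine ContinuousOn.div_const (continuousOn_const.sub ((continuousOn_id.pow 2).inv₀ ?_)) 2
      intro w hw
      exact pow_ne_zero 2 (hne w hw)
  · intro w hw
    have h1 : 1 < ‖w‖ := by simpa using hw.1.2
    have h2 : ‖w‖ < ρ := by simpa using hw.1.1
    have hne : w ≠ 0 := by rw [← norm_pos_iff]; linarith
    have hd : DifferentiableAt ℂ g ((w + w⁻¹) / 2) := hg.differentiableAt (bernsteinRegion_mem_nhds_joukowski h1 h2)
    have hj : DifferentiableAt ℂ (fun w : ℂ => (w + w⁻¹) / 2) w :=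
      (differentiableAt_id.add (differentiableAt_inv hne)).div_const 2
    refine (DifferentiableAt.comp w hd hj).mul ?_
    exact (((differentiableAt_id.pow 2).inv (pow_ne_zero 2 hne)).const_sub 1).div_const 2

theorem ellipseIntegral_inv_sub {ρ : ℝ} (hρ : 1 < ρ) {t : ℝ} (ht : t ∈ Set.Icc (-1 : ℝ) 1) :
    ellipseIntegral ρ (fun z => (z - t)⁻¹) = 2 * Real.pi * Complex.I := by
  obtain ⟨a, ha, hJ⟩ := exists_unit_joukowski_sub ht
  have ha' : ‖a⁻¹‖ = 1 := by rw [norm_inv, ha, inv_one]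
  have ha0 : a ≠ 0 := by rw [← norm_pos_iff, ha]; exact one_pos
  have hint : ∀ b : ℂ, ‖b‖ < ρ → CircleIntegrable (fun w => (w - b)⁻¹) 0 ρ := by
    intro b hb
    rw [circleIntegrable_sub_inv_iff]
    right
    rw [abs_of_pos (by linarith)]
    simpa using hb.ne
  have hval : ∀ b : ℂ, ‖b‖ < ρ → (∮ w in C(0, ρ), (w - b)⁻¹) = 2 * Real.pi * Complex.I := by
    intro b hb
    exact circleIntegral.integral_sub_inv_of_mem_ball (by simpa using hb)
  have h1 := hint a (by linarith)
  have h2 := hint a⁻¹ (by linarith)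
  have h3 := hint 0 (by simpa using by linarith)
  -- In the variable `w`, `dz / (z - t)` splits into simple poles at `a`, `a⁻¹` and `0` with
  -- residues `1`, `1`, `-1`.
  have hcongr : ellipseIntegral ρ (fun z => (z - t)⁻¹) =
      ∮ w in C(0, ρ), ((w - a)⁻¹ + (w - a⁻¹)⁻¹ - (w - 0)⁻¹) := by
    refine circleIntegral.integral_congr (by linarith) fun w hw => ?_
    have hwn : ‖w‖ = ρ := by simpa using hw
    have hw0 : w ≠ 0 := by rw [← norm_pos_iff]; linarith
    have hwa : w - a ≠ 0 := sub_ne_zero.mpr fun h => by rw [h, ha] at hwn; linarith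
    have hwa' : w - a⁻¹ ≠ 0 := sub_ne_zero.mpr fun h => by rw [h, ha'] at hwn; linarith
    have e1 : a * a⁻¹ = 1 := mul_inv_cancel₀ ha0
    show ((w + w⁻¹) / 2 - t)⁻¹ * ((1 - (w ^ 2)⁻¹) / 2) = (w - a)⁻¹ + (w - a⁻¹)⁻¹ - (w - 0)⁻¹
    rw [hJ w hw0, sub_zero]
    generalize a⁻¹ = c at *
    field_simp
    linear_combination e1
  have h12 : CircleIntegrable (fun w => (w - a)⁻¹ + (w - a⁻¹)⁻¹) 0 ρ := h1.add h2
  rw [hcongr, circleIntegral.integral_sub h12 h3, circleIntegral.integral_add h1 h2,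
    hval a (by linarith), hval a⁻¹ (by linarith), hval 0 (by simpa using by linarith)]
  ring

theorem ofReal_notMem_bernsteinEllipse {ρ : ℝ} (hρ : 1 < ρ) {t : ℝ} (ht : t ∈ Set.Icc (-1 : ℝ) 1)
    {z : ℂ} (hz : z ∈ bernsteinEllipse ρ) : z - t ≠ 0 := by
  obtain ⟨w, hw, rfl⟩ := hz
  exact joukowski_sub_ne_zero ht (by linarith)

theorem ellipseIntegral_congr {ρ : ℝ} (hρ : 1 < ρ) {f g : ℂ → ℂ}
    (h : ∀ z ∈ bernsteinEllipse ρ, f z = g z) : ellipseIntegral ρ f = ellipseIntegral ρ g := by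
  refine circleIntegral.integral_congr (by linarith) fun w hw => ?_
  have hwn : ‖w‖ = ρ := by simpa using hw
  show f _ * _ = g _ * _
  rw [h _ ⟨w, hwn, rfl⟩]

theorem ellipseIntegral_add {ρ : ℝ} (hρ : 1 < ρ) {f g : ℂ → ℂ}
    (hf : ContinuousOn f (bernsteinEllipse ρ)) (hg : ContinuousOn g (bernsteinEllipse ρ)) :
    ellipseIntegral ρ (fun z => f z + g z) = ellipseIntegral ρ f + ellipseIntegral ρ g := by
  rw [ellipseIntegral, ellipseIntegral, ellipseIntegral, ← circleIntegral.integral_add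
    (circleIntegrable_joukowski hρ hf) (circleIntegrable_joukowski hρ hg)]
  simp only [add_mul]

theorem ellipseIntegral_const_mul (ρ : ℝ) (c : ℂ) (f : ℂ → ℂ) :
    ellipseIntegral ρ (fun z => c * f z) = c * ellipseIntegral ρ f := by
  rw [ellipseIntegral, ellipseIntegral, ← circleIntegral.integral_const_mul]
  simp only [mul_assoc]

theorem ellipseIntegral_sum {ρ : ℝ} (hρ : 1 < ρ) {ι : Type*} (s : Finset ι) {f : ι → ℂ → ℂ}
    (hf : ∀ i ∈ s, ContinuousOn (f i) (bernsteinEllipse ρ)) :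
    ellipseIntegral ρ (fun z => ∑ i ∈ s, f i z) = ∑ i ∈ s, ellipseIntegral ρ (f i) := by
  classical
  induction s using Finset.induction_on with
  | empty => simp [ellipseIntegral, circleIntegral]
  | insert i s hi ih =>
    simp only [Finset.sum_insert hi]
    rw [ellipseIntegral_add hρ (hf i (by simp))
      (continuousOn_finsetSum _ fun j hj => hf j (by simp [hj])),
      ih fun j hj => hf j (by simp [hj])]

theorem continuousOn_inv_sub {ρ : ℝ} (hρ : 1 < ρ) {t : ℝ} (ht : t ∈ Set.Icc (-1 : ℝ) 1) :
    ContinuousOn (fun z : ℂ => (z - t)⁻¹) (bernsteinEllipse ρ) :=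
  ContinuousOn.inv₀ (by fun_prop) fun _ hz => ofReal_notMem_bernsteinEllipse hρ ht hz

/-- Cauchy's integral formula on the Bernstein ellipse, at points of `[-1, 1]`. -/
theorem ellipseIntegral_cauchy {ρ : ℝ} (hρ : 1 < ρ) {t : ℝ} (ht : t ∈ Set.Icc (-1 : ℝ) 1) {u : ℂ → ℂ}
    (hu : DifferentiableOn ℂ u (bernsteinRegion ρ)) :
    ellipseIntegral ρ (fun z => u z * (z - t)⁻¹) = 2 * Real.pi * Complex.I * u t := by
  -- The singularity of `(u z - u t) / (z - t)` is removable, which leaves only `u t` times the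
  -- integral of `(z - t)⁻¹`.
  have hd : DifferentiableOn ℂ (dslope u t) (bernsteinRegion ρ) :=
    (Complex.differentiableOn_dslope (bernsteinRegion_mem_nhds_ofReal hρ ht)).mpr hu
  have hsub := bernsteinEllipse_subset_bernsteinRegion hρ
  have h1 : ellipseIntegral ρ (fun z => u z * (z - t)⁻¹) =
      ellipseIntegral ρ (fun z => dslope u t z + u t * (z - t)⁻¹) := by
    refine ellipseIntegral_congr hρ fun z hz => ?_
    have hz' := ofReal_notMem_bernsteinEllipse hρ ht hz
    rw [dslope_of_ne _ (sub_ne_zero.mp hz'), slope_def_field]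
    field_simp
    ring
  have hc : ContinuousOn (fun z : ℂ => u t * (z - t)⁻¹) (bernsteinEllipse ρ) :=
    continuousOn_const.mul (continuousOn_inv_sub hρ ht)
  rw [h1, ellipseIntegral_add hρ (hd.continuousOn.mono hsub) hc, ellipseIntegral_eq_zero hρ hd,
    ellipseIntegral_const_mul, ellipseIntegral_inv_sub hρ ht]
  ring

/-! ### Hermite's error formula and its estimate. -/

/-- Hermite's contour integral for the interpolation error. -/
theorem interpolation_error_eq_ellipseIntegral {ρ : ℝ} (hρ : 1 < ρ) {u : ℂ → ℂ}
    (hu : DifferentiableOn ℂ u (bernsteinRegion ρ)) {s : Finset ℝ} (hs : s.Nonempty)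
    (hsI : ∀ t ∈ s, t ∈ Set.Icc (-1 : ℝ) 1) {x : ℝ} (hx : x ∈ Set.Icc (-1 : ℝ) 1) (hxs : x ∉ s) :
    2 * Real.pi * Complex.I *
      (u x - (Lagrange.interpolate s (fun t : ℝ => (t : ℂ)) fun t : ℝ => u t).eval (x : ℂ)) =
    (∏ t ∈ s, ((x : ℂ) - t)) *
      ellipseIntegral ρ (fun z => u z * ((∏ t ∈ s, (z - t))⁻¹ * (z - x)⁻¹)) := by
  set v : ℝ → ℂ := fun t => (t : ℂ) with hv
  have hinj : Set.InjOn v s := Complex.ofReal_injective.injOn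
  set W := Lagrange.nodalWeight s v with hW
  -- Partial fractions of the reciprocal nodal polynomial, read off from the interpolation of the
  -- constant `1`.
  have hpf : ∀ z : ℂ, (∀ t ∈ s, z ≠ v t) → (∏ t ∈ s, (z - t)) * ∑ t ∈ s, W t * (z - v t)⁻¹ = 1 := by
    intro z hz
    have h := Lagrange.eval_interpolate_not_at_node (r := 1) hz
    rw [Lagrange.interpolate_one hinj hs, eval_one, Lagrange.eval_nodal] at h
    simpa using h.symm
  have hxne : ∀ t ∈ s, (x : ℂ) ≠ v t := fun t ht h =>
    hxs (by rwa [Complex.ofReal_injective h])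
  have hcu : ContinuousOn u (bernsteinEllipse ρ) :=
    hu.continuousOn.mono (bernsteinEllipse_subset_bernsteinRegion hρ)
  -- Uses `1 / ((z - t)(z - x)) = (1 / (z - x) - 1 / (z - t)) / (x - t)`, so that Cauchy's formula
  -- applies to each term.
  have h1 : ellipseIntegral ρ (fun z => u z * ((∏ t ∈ s, (z - t))⁻¹ * (z - x)⁻¹)) =
      ellipseIntegral ρ (fun z => ∑ t ∈ s, W t * ((x : ℂ) - v t)⁻¹ *
        (u z * (z - x)⁻¹ + (-1) * (u z * (z - t)⁻¹))) := by
    refine ellipseIntegral_congr hρ fun z hz => ?_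
    have hzx := ofReal_notMem_bernsteinEllipse hρ hx hz
    have hzt : ∀ t ∈ s, z - v t ≠ 0 := fun t ht =>
      ofReal_notMem_bernsteinEllipse hρ (hsI t ht) hz
    rw [inv_eq_of_mul_eq_one_right (hpf z fun t ht => sub_ne_zero.mp (hzt t ht)), Finset.sum_mul,
      Finset.mul_sum]
    refine Finset.sum_congr rfl fun t ht => ?_
    have e1 := hzt t ht
    have e2 := sub_ne_zero.mpr (hxne t ht)
    simp only [hv] at e1 e2 ⊢
    field_simp
    ring
  have hc1 : ∀ t : ℝ, t ∈ Set.Icc (-1 : ℝ) 1 →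
      ContinuousOn (fun z : ℂ => u z * (z - t)⁻¹) (bernsteinEllipse ρ) := fun t ht =>
    hcu.mul (continuousOn_inv_sub hρ ht)
  have hc2 : ∀ t ∈ s, ContinuousOn (fun z : ℂ => (-1) * (u z * (z - t)⁻¹)) (bernsteinEllipse ρ) :=
    fun t ht => continuousOn_const.mul (hc1 t (hsI t ht))
  have hc3 : ∀ t ∈ s, ContinuousOn (fun z : ℂ => W t * ((x : ℂ) - v t)⁻¹ *
      (u z * (z - x)⁻¹ + (-1) * (u z * (z - t)⁻¹))) (bernsteinEllipse ρ) :=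
    fun t ht => continuousOn_const.mul ((hc1 x hx).add (hc2 t ht))
  rw [h1, ellipseIntegral_sum hρ s hc3,
    Lagrange.eval_interpolate_not_at_node _ hxne, Lagrange.eval_nodal]
  have h2 : ∀ t ∈ s, ellipseIntegral ρ (fun z => W t * ((x : ℂ) - v t)⁻¹ *
        (u z * (z - x)⁻¹ + (-1) * (u z * (z - t)⁻¹))) =
      2 * Real.pi * Complex.I * u x * (W t * ((x : ℂ) - v t)⁻¹) -
        2 * Real.pi * Complex.I * (W t * ((x : ℂ) - v t)⁻¹ * u t) := by
    intro t ht
    rw [ellipseIntegral_const_mul, ellipseIntegral_add hρ (hc1 x hx) (hc2 t ht), ellipseIntegral_const_mul,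
      ellipseIntegral_cauchy hρ hx hu, ellipseIntegral_cauchy hρ (hsI t ht) hu]
    ring
  rw [Finset.sum_congr rfl h2, Finset.sum_sub_distrib, ← Finset.mul_sum, ← Finset.mul_sum]
  have h3 := hpf x hxne
  simp only [hv] at h3 ⊢
  linear_combination -(2 * Real.pi * Complex.I * u x) * h3

theorem norm_circleMap_sub_inv_sq {ρ : ℝ} (hρ : 0 < ρ) (θ : ℝ) :
    ‖circleMap 0 ρ θ - (circleMap 0 ρ θ)⁻¹‖ ^ 2 =
      ρ ^ 2 + (ρ ^ 2)⁻¹ - 2 * Real.cos (2 * θ) := by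
  have h : circleMap 0 ρ θ - (circleMap 0 ρ θ)⁻¹ =
      ((ρ - ρ⁻¹) * Real.cos θ : ℝ) + ((ρ + ρ⁻¹) * Real.sin θ : ℝ) * Complex.I := by
    rw [circleMap, zero_add, mul_inv, ← Complex.exp_neg, Complex.exp_mul_I, ← neg_mul,
      Complex.exp_mul_I, Complex.cos_neg, Complex.sin_neg]
    push_cast
    ring
  rw [h, ← Complex.normSq_eq_norm_sq, Complex.normSq_add_mul_I, Real.cos_two_mul]
  have h1 := Real.sin_sq_add_cos_sq θ
  have h2 : ρ * ρ⁻¹ = 1 := mul_inv_cancel₀ hρ.ne'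
  rw [← inv_pow]
  linear_combination (ρ + ρ⁻¹) ^ 2 * h1 + (2 - 4 * Real.cos θ ^ 2) * h2

/-- The length of the Bernstein ellipse is at most `π √(ρ² + ρ⁻²)`. -/
theorem norm_ellipseIntegral_le {ρ : ℝ} (hρ : 1 < ρ) {g : ℂ → ℂ} {K : ℝ}
    (hg : ∀ z ∈ bernsteinEllipse ρ, ‖g z‖ ≤ K) :
    ‖ellipseIntegral ρ g‖ ≤ Real.pi * Real.sqrt (ρ ^ 2 + (ρ ^ 2)⁻¹) * K := by
  have hρ0 : 0 < ρ := by linarith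
  set s := Real.sqrt (ρ ^ 2 + (ρ ^ 2)⁻¹) with hs
  have hs2 : s ^ 2 = ρ ^ 2 + (ρ ^ 2)⁻¹ := Real.sq_sqrt (by positivity)
  have hspos : 0 < s := Real.sqrt_pos.mpr (by positivity)
  have hK : 0 ≤ K := (norm_nonneg _).trans (hg _ ⟨ρ, by simp [abs_of_pos hρ0], rfl⟩)
  -- With `y = |w - w⁻¹|` and `y² = s² - 2 cos 2θ`, the inequality `y ≤ (y² + s²) / (2s)` removes
  -- the square root; the cosine then integrates to zero over a period.
  set G : ℝ → ℝ := fun θ => K / 2 * s - K / (2 * s) * Real.cos (2 * θ) with hG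
  have hGc : Continuous G := by fun_prop
  have hbound : ‖ellipseIntegral ρ g‖ ≤ ∫ θ in (0 : ℝ)..2 * Real.pi, G θ := by
    rw [ellipseIntegral, circleIntegral]
    refine intervalIntegral.norm_integral_le_of_norm_le Real.two_pi_pos.le
      (Eventually.of_forall fun θ _ => ?_) (hGc.intervalIntegrable _ _)
    set c := circleMap 0 ρ θ with hc
    have hcn : ‖c‖ = ρ := by simp [hc, abs_of_pos hρ0]
    have hc0 : c ≠ 0 := by rw [← norm_pos_iff]; linarith
    have hsq := norm_circleMap_sub_inv_sq hρ0 θ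
    rw [← hc, ← hs2] at hsq
    have e : deriv (circleMap 0 ρ) θ • (g ((c + c⁻¹) / 2) * ((1 - (c ^ 2)⁻¹) / 2)) =
        Complex.I * g ((c + c⁻¹) / 2) * ((c - c⁻¹) / 2) := by
      rw [deriv_circleMap, ← hc, smul_eq_mul]
      field_simp
    rw [e, norm_mul, norm_mul, Complex.norm_I, one_mul, norm_div, Complex.norm_two]
    have hamgm : ‖c - c⁻¹‖ ≤ s - Real.cos (2 * θ) / s := by
      have : s - Real.cos (2 * θ) / s = (‖c - c⁻¹‖ ^ 2 + s ^ 2) / (2 * s) := by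
        rw [hsq]
        field_simp
        ring
      rw [this, le_div_iff₀ (by positivity)]
      nlinarith [sq_nonneg (‖c - c⁻¹‖ - s)]
    calc _ ≤ K * ((s - Real.cos (2 * θ) / s) / 2) := by
          gcongr
          exact hg _ ⟨c, hcn, rfl⟩
      _ = G θ := by
          simp only [hG]
          field_simp
  refine hbound.trans (le_of_eq ?_)
  have hcos : ∫ θ in (0 : ℝ)..2 * Real.pi, Real.cos (2 * θ) = 0 := by
    rw [intervalIntegral.integral_comp_mul_left _ two_ne_zero, integral_cos,
      show 2 * (2 * Real.pi) = (4 : ℕ) * Real.pi by push_cast; ring, Real.sin_nat_mul_pi]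
    simp
  simp only [hG]
  rw [intervalIntegral.integral_sub (continuous_const.intervalIntegrable _ _)
    ((by fun_prop : Continuous fun θ : ℝ => K / (2 * s) * Real.cos (2 * θ)).intervalIntegrable _ _),
    intervalIntegral.integral_const_mul, intervalIntegral.integral_const_mul, hcos,
    intervalIntegral.integral_const]
  simp only [smul_eq_mul]
  ring

theorem norm_interpolation_error_le {ρ : ℝ} (hρ : 1 < ρ) {u : ℂ → ℂ}
    (hu : DifferentiableOn ℂ u (bernsteinRegion ρ)) {p : ℝ[X]} (hp : p ≠ 0) {s : Finset ℝ}
    (hcard : p.natDegree ≤ s.card) (hs : s.Nonempty)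
    (hroot : ∀ t ∈ s, t ∈ Set.Icc (-1 : ℝ) 1 ∧ p.eval t = 0) {q : ℝ} (hq : 0 < q)
    (hpq : ∀ w : ℂ, ‖w‖ = ρ → q ≤ ‖aeval ((w + w⁻¹) / 2) p‖) {x : ℝ}
    (hx : x ∈ Set.Icc (-1 : ℝ) 1) :
    ‖u x - (Lagrange.interpolate s (fun t : ℝ => (t : ℂ)) fun t : ℝ => u t).eval (x : ℂ)‖ ≤
      Real.sqrt (ρ ^ 2 + (ρ ^ 2)⁻¹) / 2 * (maxOnEllipse ρ u / (q * ((ρ - 1) ^ 2 / (2 * ρ)))) *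
        |p.eval x| := by
  by_cases hxs : x ∈ s
  · rw [Lagrange.eval_interpolate_at_node (v := fun t : ℝ => (t : ℂ)) (r := fun t : ℝ => u t)
      Complex.ofReal_injective.injOn hxs, (hroot x hxs).2]
    simp
  have h := interpolation_error_eq_ellipseIntegral hρ hu hs (fun t ht => (hroot t ht).1) hx hxs
  set E := u x - (Lagrange.interpolate s (fun t : ℝ => (t : ℂ)) fun t : ℝ => u t).eval (x : ℂ)
  have hprod := aeval_eq_prod_of_card_ge hp hcard fun t ht => (hroot t ht).2
  have hlc : (p.leadingCoeff : ℂ) ≠ 0 := by exact_mod_cast leadingCoeff_ne_zero.mpr hp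
  have hd : 0 < (ρ - 1) ^ 2 / (2 * ρ) := div_pos (pow_pos (by linarith) 2) (by linarith)
  have hI : (∏ t ∈ s, ((x : ℂ) - t)) *
      ellipseIntegral ρ (fun z => u z * ((∏ t ∈ s, (z - t))⁻¹ * (z - x)⁻¹)) =
      (p.eval x : ℝ) * ellipseIntegral ρ (fun z => u z * ((aeval z p)⁻¹ * (z - x)⁻¹)) := by
    rw [← ellipseIntegral_const_mul, ← ellipseIntegral_const_mul, ← aeval_ofReal_eq, hprod]
    congr 1
    funext z
    rw [hprod, mul_inv]
    field_simp
  rw [hI] at h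
  have hbd := norm_ellipseIntegral_le hρ
    (g := fun z => u z * ((aeval z p)⁻¹ * (z - x)⁻¹))
    (K := maxOnEllipse ρ u / (q * ((ρ - 1) ^ 2 / (2 * ρ)))) (by
      rintro z ⟨w, hw, rfl⟩
      have h1 := hpq w hw
      have h2 := norm_joukowski_sub_ge hx hρ hw
      have h3 := norm_le_maxOnEllipse hρ
        (hu.continuousOn.mono (bernsteinEllipse_subset_bernsteinRegion hρ)) ⟨w, hw, rfl⟩
      rw [norm_mul, norm_mul, norm_inv, norm_inv, ← mul_inv, ← div_eq_mul_inv]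
      exact div_le_div₀ ((norm_nonneg _).trans h3) h3 (mul_pos hq hd)
        (mul_le_mul h1 h2 hd.le (norm_nonneg _)))
  have hn := congrArg norm h
  rw [norm_mul, norm_mul, norm_mul, norm_mul, Complex.norm_I, Complex.norm_real, Complex.norm_real,
    Complex.norm_two, Real.norm_of_nonneg Real.pi_pos.le, Real.norm_eq_abs, mul_one] at hn
  have h4 : 2 * Real.pi * ‖E‖ ≤ 2 * Real.pi * (Real.sqrt (ρ ^ 2 + (ρ ^ 2)⁻¹) / 2 *
      (maxOnEllipse ρ u / (q * ((ρ - 1) ^ 2 / (2 * ρ)))) * |p.eval x|) := by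
    rw [hn]
    calc _ ≤ |p.eval x| * _ := mul_le_mul_of_nonneg_left hbd (abs_nonneg _)
      _ = _ := by ring
  exact le_of_mul_le_mul_left h4 Real.two_pi_pos

/-- Comparison of derivatives at a common zero. -/
theorem norm_deriv_le_of_norm_le_mul {f : ℝ → ℂ} {p : ℝ[X]} {K x : ℝ} {f' : ℂ}
    (hx : x ∈ Set.Icc (-1 : ℝ) 1) (hf : HasDerivAt f f' x) (hfx : f x = 0) (hpx : p.eval x = 0)
    (h : ∀ y ∈ Set.Icc (-1 : ℝ) 1, ‖f y‖ ≤ K * |p.eval y|) :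
    ‖f'‖ ≤ K * |(derivative p).eval x| := by
  -- Slopes are taken within `[-1, 1]` because the bound holds only there and the zero may be an
  -- endpoint.
  have h1 := (hasDerivWithinAt_iff_tendsto_slope.mp
    (hf.hasDerivWithinAt (s := Set.Icc (-1 : ℝ) 1))).norm
  have h2 := ((hasDerivWithinAt_iff_tendsto_slope.mp
    ((p.hasDerivAt x).hasDerivWithinAt (s := Set.Icc (-1 : ℝ) 1))).abs).const_mul K
  have hne : (𝓝[Set.Icc (-1 : ℝ) 1 \ {x}] x).NeBot := by
    have := (uniqueDiffOn_Icc (show (-1 : ℝ) < 1 by norm_num) x hx).accPt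
    rwa [accPt_principal_iff_nhdsWithin] at this
  refine le_of_tendsto_of_tendsto h1 h2 ?_
  filter_upwards [self_mem_nhdsWithin] with y hy
  have hyx : 0 < |y - x| := abs_pos.mpr (sub_ne_zero.mpr hy.2)
  rw [slope_def_field, slope_def_module, hfx, hpx, sub_zero, sub_zero, norm_smul, abs_div,
    norm_inv, Real.norm_eq_abs, ← div_eq_inv_mul, mul_div_assoc']
  exact div_le_div_of_nonneg_right (h y hy.1) hyx.le

/-! ### Gamma function asymptotics. -/

theorem tendsto_risingCoeff_div_rpow {s : ℝ} (hs : 0 < s) :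
    Tendsto (fun k : ℕ => risingCoeff s k / ((k : ℝ) + 1) ^ (s - 1)) atTop (𝓝 (Real.Gamma s)⁻¹) := by
  have hprod : ∀ n : ℕ, ∏ j ∈ Finset.range n, (s + j) = n.factorial * risingCoeff s n := by
    intro n
    induction n with
    | zero => simp [risingCoeff_zero]
    | succ n ih =>
      rw [Finset.prod_range_succ, ih, Nat.factorial_succ]
      push_cast
      linear_combination -(n.factorial : ℝ) * risingCoeff_succ s n
  have hG := ((Real.GammaSeq_tendsto_Gamma s).comp (tendsto_add_atTop_nat 1)).inv₀
    (Real.Gamma_pos_of_pos hs).ne'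
  have hlin : ∀ a b : ℝ, Tendsto (fun k : ℕ => 1 + a / ((k : ℝ) + b)) atTop (𝓝 (1 + 0)) :=
    fun a b => tendsto_const_nhds.add (Tendsto.const_div_atTop
      (tendsto_atTop_add_const_right _ _ tendsto_natCast_atTop_atTop) _)
  -- The Gamma sequence is taken at `k + 1`; the factors `(k + 1) / (k + s)` and `(k + 1) / (k + s +
  -- 1)` correct the index.
  have h := (hG.mul (hlin (1 - s) s)).mul (hlin (-s) (s + 1))
  simp only [add_zero, mul_one] at h
  refine h.congr fun k => ?_
  have h0 := risingCoeff_pos hs k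
  have h1 := risingCoeff_pos hs (k + 1)
  have e := risingCoeff_succ s k
  have hk : (0 : ℝ) < (k : ℝ) + 1 := by positivity
  have hks : (0 : ℝ) < (k : ℝ) + s := by positivity
  have hks1 : (0 : ℝ) < (k : ℝ) + (s + 1) := by positivity
  have hpow : ((k : ℝ) + 1) ^ s = ((k : ℝ) + 1) ^ (s - 1) * (k + 1) := by
    rw [← Real.rpow_add_one hk.ne', sub_add_cancel]
  have hP : 0 < ((k : ℝ) + 1) ^ (s - 1) := Real.rpow_pos_of_pos hk _
  have hf : (0 : ℝ) < (k + 1).factorial := by exact_mod_cast Nat.factorial_pos _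
  have e' : risingCoeff s k = (k + 1) * risingCoeff s (k + 1) / (k + s) := by
    rw [eq_div_iff hks.ne']
    linear_combination -e
  rw [Function.comp_apply, Real.GammaSeq, Finset.prod_range_succ, hprod, e']
  push_cast
  rw [hpow]
  generalize ((k : ℝ) + 1) ^ (s - 1) = P at *
  have hks' : (0 : ℝ) < s + (k + 1) := by positivity
  field_simp
  ring

theorem tendsto_risingCoeff_ratio {m : ℝ} (hm : 0 < m) :
    Tendsto (fun k : ℕ => risingCoeff (2 * m) k / risingCoeff m k / ((k : ℝ) + 1) ^ m) atTop
      (𝓝 (Real.Gamma m / Real.Gamma (2 * m))) := by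
  have h := (tendsto_risingCoeff_div_rpow (show 0 < 2 * m by linarith)).div
    (tendsto_risingCoeff_div_rpow hm) (inv_ne_zero (Real.Gamma_pos_of_pos hm).ne')
  rw [inv_div_inv] at h
  refine h.congr fun k => ?_
  have hk : (0 : ℝ) < (k : ℝ) + 1 := by positivity
  have h1 := risingCoeff_pos hm k
  have hP : 0 < ((k : ℝ) + 1) ^ (m - 1) := Real.rpow_pos_of_pos hk _
  have hQ : 0 < ((k : ℝ) + 1) ^ m := Real.rpow_pos_of_pos hk _
  have e : ((k : ℝ) + 1) ^ (2 * m - 1) = ((k : ℝ) + 1) ^ m * ((k : ℝ) + 1) ^ (m - 1) := by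
    rw [← Real.rpow_add hk]
    congr 1
    ring
  rw [Pi.div_apply, e]
  field_simp

/-! ### The Lobatto polynomial, its zeros and its bounds. -/

/-- At `x = 1` the term with `1 - x^2` drops out of the Rodrigues relation. -/
theorem derivative_gegenbauer_eval_at_one {m : ℝ} (hm : 0 < m) (k : ℕ) :
    (derivative (gegenbauer m k)).eval 1 =
      k * (k + 2 * m) / (2 * m + 1) * (gegenbauer m k).eval 1 := by
  cases k with
  | zero => simp [gegenbauer_zero]
  | succ k =>
    have h := gegenbauer_rodrigues_step hm 1 k
    rw [derivative_gegenbauer_eval hm, div_mul_eq_mul_div, eq_div_iff (by positivity)]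
    push_cast
    linear_combination -h

theorem abs_derivative_gegenbauer_eval_le {m : ℝ} (hm : 0 < m) (k : ℕ) {x : ℝ}
    (hx : x ∈ Set.Icc (-1 : ℝ) 1) :
    |(derivative (gegenbauer m k)).eval x| ≤
      k * (k + 2 * m) / (2 * m + 1) * (gegenbauer m k).eval 1 := by
  rw [← derivative_gegenbauer_eval_at_one hm]
  cases k with
  | zero => simp [gegenbauer_zero]
  | succ k =>
    rw [derivative_gegenbauer_eval hm, derivative_gegenbauer_eval hm, abs_mul,
      abs_of_pos (by linarith : 0 < 2 * m)]
    exact mul_le_mul_of_nonneg_left (abs_gegenbauer_eval_le (by linarith) k hx) (by linarith)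

/-- The polynomial whose zeros are the Gegenbauer-Gauss-Lobatto points. -/
noncomputable def lobattoPoly (m : ℝ) (k : ℕ) : ℝ[X] := (1 - X ^ 2) * gegenbauer m k

theorem lobattoPoly_eval (m : ℝ) (k : ℕ) (x : ℝ) :
    (lobattoPoly m k).eval x = (1 - x ^ 2) * (gegenbauer m k).eval x := by
  simp [lobattoPoly]

theorem lobattoPoly_ne_zero {m : ℝ} (hm : 0 < m) (k : ℕ) : lobattoPoly m k ≠ 0 := by
  refine mul_ne_zero (fun h => ?_) (gegenbauer_ne_zero hm k)
  have := congrArg (eval 0) h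
  simp at this

theorem natDegree_lobattoPoly_le (m : ℝ) (k : ℕ) : (lobattoPoly m k).natDegree ≤ k + 2 := by
  refine natDegree_mul_le.trans ?_
  have h1 : (1 - X ^ 2 : ℝ[X]).natDegree ≤ 2 := by compute_degree
  have h2 := natDegree_gegenbauer_le m k
  omega

/-- The points `±1` and the `n - 1` interior zeros already exhaust the degree, so there are no other
roots. -/
theorem lobattoNodes_properties {l : ℝ} (hl : 0 < l + 1) {n : ℕ} (hn : 1 ≤ n) :
    (lobattoNodes l n).card = n + 1 ∧
      ∀ t ∈ lobattoNodes l n, t ∈ Set.Icc (-1 : ℝ) 1 ∧ (lobattoPoly (l + 1) (n - 1)).eval t = 0 := by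
  obtain ⟨s, hc, hs⟩ := exists_zero_finset_gegenbauer hl (n - 1)
  set s' : Finset ℝ := insert (-1) (insert 1 s) with hs'
  have hm1 : (1 : ℝ) ∉ s := fun h => (hs 1 h).1.2.ne rfl
  have hm2 : (-1 : ℝ) ∉ insert 1 s := by
    rw [Finset.mem_insert, not_or]
    exact ⟨by norm_num, fun h => (hs _ h).1.1.ne rfl⟩
  have hcard : s'.card = n + 1 := by
    rw [hs', Finset.card_insert_of_notMem hm2, Finset.card_insert_of_notMem hm1, hc]
    omega
  have hprop : ∀ t ∈ s', t ∈ Set.Icc (-1 : ℝ) 1 ∧ (lobattoPoly (l + 1) (n - 1)).eval t = 0 := by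
    intro t ht
    rw [lobattoPoly_eval]
    simp only [hs', Finset.mem_insert] at ht
    rcases ht with rfl | rfl | ht
    · norm_num
    · norm_num
    · exact ⟨Set.Ioo_subset_Icc_self (hs t ht).1, by rw [(hs t ht).2, mul_zero]⟩
  have hroots := roots_eq_of_card_ge (lobattoPoly_ne_zero hl (n - 1)) (s := s')
    ((natDegree_lobattoPoly_le _ _).trans (by omega)) fun t ht => (hprop t ht).2
  have hnodes : lobattoNodes l n = s' := by
    rw [lobattoNodes, ← lobattoPoly, hroots, Finset.val_toFinset]
  rw [hnodes]
  exact ⟨hcard, hprop⟩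

theorem abs_lobattoPoly_eval_le {m : ℝ} (hm : 0 < m) (k : ℕ) {x : ℝ} (hx : x ∈ Set.Icc (-1 : ℝ) 1) :
    |(lobattoPoly m k).eval x| ≤ (gegenbauer m k).eval 1 := by
  have h1 : 0 ≤ 1 - x ^ 2 := by nlinarith [hx.1, hx.2]
  rw [lobattoPoly_eval, abs_mul, abs_of_nonneg h1]
  refine (mul_le_of_le_one_left (abs_nonneg _) (by nlinarith)).trans
    (abs_gegenbauer_eval_le hm k hx)

theorem abs_derivative_lobattoPoly_eval_le {m : ℝ} (hm : 0 < m) (k : ℕ) {x : ℝ}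
    (hx : x ∈ Set.Icc (-1 : ℝ) 1) :
    |(derivative (lobattoPoly m k)).eval x| ≤
      (2 + k * (k + 2 * m) / (2 * m + 1)) * (gegenbauer m k).eval 1 := by
  have h1 : 0 ≤ 1 - x ^ 2 := by nlinarith [hx.1, hx.2]
  have h2 : |x| ≤ 1 := abs_le.mpr hx
  have e : (derivative (lobattoPoly m k)).eval x =
      -(2 * x * (gegenbauer m k).eval x) + (1 - x ^ 2) * (derivative (gegenbauer m k)).eval x := by
    simp [lobattoPoly, one_add_one_eq_two]
  have h3 := abs_gegenbauer_eval_le hm k hx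
  rw [e, add_mul]
  refine (abs_add_le _ _).trans (add_le_add ?_ ?_)
  · rw [abs_neg, abs_mul, abs_mul, abs_two]
    have := mul_le_mul h2 h3 (abs_nonneg _) zero_le_one
    linarith
  · rw [abs_mul, abs_of_nonneg h1]
    exact (mul_le_of_le_one_left (abs_nonneg _) (by nlinarith)).trans
      (abs_derivative_gegenbauer_eval_le hm k hx)

theorem norm_lobattoPoly_joukowski_ge {m ρ L : ℝ} (hρ : 1 < ρ) {k : ℕ} {w : ℂ} (hw : ‖w‖ = ρ)
    (hL : 0 ≤ L) (h : L ≤ ‖aeval ((w + w⁻¹) / 2) (gegenbauer m k)‖) :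
    (ρ - ρ⁻¹) ^ 2 / 4 * L ≤ ‖aeval ((w + w⁻¹) / 2) (lobattoPoly m k)‖ := by
  rw [lobattoPoly, map_mul, norm_mul]
  refine mul_le_mul ?_ h hL (norm_nonneg _)
  simpa using norm_one_sub_joukowski_sq_ge hρ hw

/-- The pointwise estimates from which both error bounds follow. -/
theorem lobatto_error_le {l ρ L : ℝ} (hl : 0 < l + 1) (hρ : 1 < ρ) {n : ℕ} (hn : 1 ≤ n) (hL : 0 < L)
    (hlow : ∀ w : ℂ, ‖w‖ = ρ → L ≤ ‖aeval ((w + w⁻¹) / 2) (gegenbauer (l + 1) (n - 1))‖)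
    {u : ℂ → ℂ} (hu : AnalyticOnNhd ℂ u (bernsteinRegion ρ)) {x : ℝ} (hx : x ∈ Set.Icc (-1 : ℝ) 1) :
    ‖u x - (lobattoInterp l n u).eval (x : ℂ)‖ ≤
      Real.sqrt (ρ ^ 2 + (ρ ^ 2)⁻¹) / 2 *
        (maxOnEllipse ρ u / ((ρ - ρ⁻¹) ^ 2 / 4 * L * ((ρ - 1) ^ 2 / (2 * ρ)))) *
        |(lobattoPoly (l + 1) (n - 1)).eval x| := by
  obtain ⟨hc, hp⟩ := lobattoNodes_properties hl hn
  have hpos : 0 < ρ - ρ⁻¹ := by linarith [inv_lt_one_of_one_lt₀ hρ]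
  exact norm_interpolation_error_le hρ hu.differentiableOn (lobattoPoly_ne_zero hl (n - 1))
    ((natDegree_lobattoPoly_le _ _).trans (by omega)) (Finset.card_pos.mp (by omega)) hp
    (by positivity) (fun w hw => norm_lobattoPoly_joukowski_ge hρ hw hL.le (hlow w hw)) hx

theorem lobatto_deriv_error_le {l ρ K : ℝ} (hl : 0 < l + 1) (hρ : 1 < ρ) {n : ℕ} (hn : 1 ≤ n)
    {u : ℂ → ℂ} (hu : AnalyticOnNhd ℂ u (bernsteinRegion ρ))
    (hE : ∀ x ∈ Set.Icc (-1 : ℝ) 1, ‖u x - (lobattoInterp l n u).eval (x : ℂ)‖ ≤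
      K * |(lobattoPoly (l + 1) (n - 1)).eval x|) {x : ℝ} (hx : x ∈ lobattoNodes l n) :
    ‖deriv (fun t : ℝ => u (t : ℂ) - (lobattoInterp l n u).eval (t : ℂ)) x‖ ≤
      K * |(derivative (lobattoPoly (l + 1) (n - 1))).eval x| := by
  obtain ⟨hxI, hx0⟩ := (lobattoNodes_properties hl hn).2 x hx
  have hd : DifferentiableAt ℝ
      (fun t : ℝ => u (t : ℂ) - (lobattoInterp l n u).eval (t : ℂ)) x := by
    have h1 : DifferentiableAt ℂ (fun z => u z - (lobattoInterp l n u).eval z) (x : ℂ) :=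
      (hu x (mem_of_mem_nhds (bernsteinRegion_mem_nhds_ofReal hρ hxI))).differentiableAt.sub
        (lobattoInterp l n u).differentiableAt
    exact h1.hasDerivAt.comp_ofReal.differentiableAt
  have hfx : u (x : ℂ) - (lobattoInterp l n u).eval (x : ℂ) = 0 := by
    have := hE x hxI
    rw [hx0, abs_zero, mul_zero] at this
    exact norm_le_zero_iff.mp this
  exact norm_deriv_le_of_norm_le_mul hxI hd.hasDerivAt hfx hx0 hE

/-! ### The constants and the final estimate. -/

/-- The factor comparing the two sides of the estimate of the interpolation error. -/
noncomputable def errorConst (m ρ : ℝ) (L : ℕ → ℝ) (k : ℕ) : ℝ :=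
  risingCoeff (2 * m) k / risingCoeff m k / ((k : ℝ) + 1) ^ m / (Real.Gamma m / Real.Gamma (2 * m)) *
    ((1 + (ρ ^ 2)⁻¹) ^ (-m) / L k)

/-- The additional factor for the derivative. -/
noncomputable def derivConst (m : ℝ) (k : ℕ) : ℝ :=
  (2 + k * (k + 2 * m) / (2 * m + 1)) * (2 * m + 1) / ((k : ℝ) + 1) ^ 2

theorem errorConst_pos {m ρ : ℝ} (hm : 0 < m) {L : ℕ → ℝ} (hL : ∀ k, 0 < L k) (k : ℕ) :
    0 < errorConst m ρ L k := by
  have h1 := risingCoeff_pos hm k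
  have h2 := risingCoeff_pos (show 0 < 2 * m by linarith) k
  have h3 := Real.Gamma_pos_of_pos hm
  have h4 := Real.Gamma_pos_of_pos (show 0 < 2 * m by linarith)
  have h5 := hL k
  rw [errorConst]
  positivity

theorem tendsto_errorConst {m ρ : ℝ} (hm : 0 < m) {L : ℕ → ℝ}
    (hL : Tendsto L atTop (𝓝 ((1 + (ρ ^ 2)⁻¹) ^ (-m)))) :
    Tendsto (errorConst m ρ L) atTop (𝓝 1) := by
  have h3 := Real.Gamma_pos_of_pos hm
  have h4 := Real.Gamma_pos_of_pos (show 0 < 2 * m by linarith)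
  have h5 : (0 : ℝ) < (1 + (ρ ^ 2)⁻¹) ^ (-m) := by positivity
  have h := ((tendsto_risingCoeff_ratio hm).div_const (Real.Gamma m / Real.Gamma (2 * m))).mul
    ((tendsto_const_nhds (x := (1 + (ρ ^ 2)⁻¹) ^ (-m))).div hL h5.ne')
  rw [div_self (div_pos h3 h4).ne', div_self h5.ne', mul_one] at h
  exact h

theorem tendsto_derivConst {m : ℝ} (hm : 0 < m) : Tendsto (derivConst m) atTop (𝓝 1) := by
  have h : Tendsto (fun k : ℕ => ((k : ℝ) + 1)) atTop atTop :=
    tendsto_atTop_add_const_right _ _ tendsto_natCast_atTop_atTop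
  have h1 : Tendsto (fun k : ℕ => 1 + (2 * m - 2) / ((k : ℝ) + 1) + (2 * m + 3) / ((k : ℝ) + 1) ^ 2)
      atTop (𝓝 (1 + 0 + 0)) :=
    (tendsto_const_nhds.add (h.const_div_atTop _)).add
      (Tendsto.const_div_atTop ((tendsto_pow_atTop two_ne_zero).comp h) _)
  rw [add_zero, add_zero] at h1
  refine h1.congr fun k => ?_
  rw [derivConst]
  field_simp
  ring

end GegenbauerLobatto

theorem theorem4p3 (l : ℝ) (hl : -1 / 2 < l) (ρ : ℝ) (hρ : 1 < ρ) :
    ∃ c : ℕ → ℝ, (∀ n, 0 < c n) ∧ Filter.Tendsto c Filter.atTop (nhds 1) ∧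
      ∀ n : ℕ, 1 ≤ n →
        (lobattoNodes l n).card = n + 1 ∧
        ∀ u : ℂ → ℂ, AnalyticOnNhd ℂ u (bernsteinRegion ρ) →
          (∀ x ∈ Set.Icc (-1 : ℝ) 1,
            ‖u (x : ℂ) - (lobattoInterp l n u).eval (x : ℂ)‖ ≤
              4 * c n * maxOnEllipse ρ u * Real.sqrt (ρ ^ 2 + (ρ ^ 2)⁻¹)
                  * (1 + (ρ ^ 2)⁻¹) ^ (l + 1)
                / ((1 - ρ⁻¹) ^ 2 * (ρ - ρ⁻¹) ^ 2)
                * (Real.Gamma (l + 1) / Real.Gamma (2 * l + 2))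
                * ((n : ℝ) ^ (l + 1) / ρ ^ n)) ∧
          (∀ x ∈ lobattoNodes l n,
            ‖deriv (fun t : ℝ => u (t : ℂ) - (lobattoInterp l n u).eval (t : ℂ)) x‖ ≤
              8 * c n * maxOnEllipse ρ u * Real.sqrt (ρ ^ 2 + (ρ ^ 2)⁻¹)
                  * (1 + (ρ ^ 2)⁻¹) ^ (l + 1)
                / ((1 - ρ⁻¹) ^ 2 * (ρ - ρ⁻¹) ^ 2)
                * (Real.Gamma (l + 2) / Real.Gamma (2 * l + 4))
                * ((n : ℝ) ^ (l + 3) / ρ ^ n)) := by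
  set m := l + 1 with hm_def
  have hm : 0 < m := by linarith
  have hρ0 : 0 < ρ := by linarith
  obtain ⟨L, hLpos, hLlim, hLle⟩ := exists_lower_bound_gegenbauer hm hρ
  have hTpos := errorConst_pos (ρ := ρ) hm hLpos
  have hTlim := tendsto_errorConst hm hLlim
  -- The maximum lets one sequence serve both (a), which needs the factor `1`, and (b), which needs
  -- `derivConst`. The truncated value at `n = 0` only has to be positive.
  set c : ℕ → ℝ := fun n => errorConst m ρ L (n - 1) * max 1 (derivConst m (n - 1)) with hc_def
  refine ⟨c, fun n => mul_pos (hTpos _) (by positivity), ?_, fun n hn => ?_⟩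
  · have h := hTlim.mul ((tendsto_const_nhds (x := (1 : ℝ))).max (tendsto_derivConst hm))
    rw [max_self, mul_one] at h
    exact h.comp (Filter.tendsto_sub_atTop_nat 1)
  obtain ⟨k, rfl⟩ : ∃ k, n = k + 1 := ⟨n - 1, by omega⟩
  refine ⟨(lobattoNodes_properties hm hn).1, fun u hu => ?_⟩
  have hak := risingCoeff_pos hm k
  have hA : 0 < risingCoeff m k * ρ ^ k * L k := mul_pos (by positivity) (hLpos k)
  have hinv : ρ⁻¹ < 1 := inv_lt_one_of_one_lt₀ hρ
  have hd1 : 0 < ρ - ρ⁻¹ := by linarith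
  have hd2 : 0 < 1 - ρ⁻¹ := by linarith
  have hM : 0 ≤ maxOnEllipse ρ u := (norm_nonneg _).trans (norm_le_maxOnEllipse hρ
    (hu.continuousOn.mono (bernsteinEllipse_subset_bernsteinRegion hρ))
    ⟨ρ, by simp [abs_of_pos hρ0], rfl⟩)
  have hΓ := Real.Gamma_pos_of_pos hm
  have hΓ2 := Real.Gamma_pos_of_pos (show 0 < 2 * m by linarith)
  have hnpos : (0 : ℝ) < (k : ℝ) + 1 := by positivity
  have hnm : 0 < ((k : ℝ) + 1) ^ m := Real.rpow_pos_of_pos hnpos _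
  have hB : (0 : ℝ) < (1 + (ρ ^ 2)⁻¹) ^ m := by positivity
  have hLk := hLpos k
  set K := Real.sqrt (ρ ^ 2 + (ρ ^ 2)⁻¹) / 2 * (maxOnEllipse ρ u /
    ((ρ - ρ⁻¹) ^ 2 / 4 * (risingCoeff m k * ρ ^ k * L k) * ((ρ - 1) ^ 2 / (2 * ρ)))) with hK
  have hE : ∀ x ∈ Set.Icc (-1 : ℝ) 1, ‖u x - (lobattoInterp l (k + 1) u).eval (x : ℂ)‖ ≤
      K * |(lobattoPoly m k).eval x| := fun x hx => lobatto_error_le hm hρ hn hA (hLle k) hu hx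
  have hK0 : 0 ≤ K := by positivity
  have hKC : K * (gegenbauer m k).eval 1 =
      4 * errorConst m ρ L k * maxOnEllipse ρ u * Real.sqrt (ρ ^ 2 + (ρ ^ 2)⁻¹)
        * (1 + (ρ ^ 2)⁻¹) ^ m / ((1 - ρ⁻¹) ^ 2 * (ρ - ρ⁻¹) ^ 2)
        * (Real.Gamma m / Real.Gamma (2 * m)) * (((k : ℝ) + 1) ^ m / ρ ^ (k + 1)) := by
    have hsq : (ρ - 1) ^ 2 / (2 * ρ) = ρ * (1 - ρ⁻¹) ^ 2 / 2 := by
      field_simp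
    rw [hK, errorConst, gegenbauer_eval_at_one, hsq, Real.rpow_neg (by positivity), pow_succ]
    generalize 1 - ρ⁻¹ = d2 at *
    generalize ρ - ρ⁻¹ = d1 at *
    field_simp
    ring
  have hmono : ∀ {a : ℝ}, a ≤ c (k + 1) → ∀ {S X Y Z : ℝ}, 0 ≤ S → 0 ≤ X → 0 ≤ Y → 0 ≤ Z →
      4 * a * maxOnEllipse ρ u * S * (1 + (ρ ^ 2)⁻¹) ^ m / X * Y * Z ≤
        4 * c (k + 1) * maxOnEllipse ρ u * S * (1 + (ρ ^ 2)⁻¹) ^ m / X * Y * Z := by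
    intro a ha S X Y Z hS hX hY hZ
    gcongr
  have hl2 : 2 * l + 2 = 2 * m := by rw [hm_def]; ring
  refine ⟨fun x hx => ?_, fun x hx => ?_⟩
  · rw [hl2]
    push_cast
    refine (hE x hx).trans ((mul_le_mul_of_nonneg_left (abs_lobattoPoly_eval_le hm k hx) hK0).trans
      (hKC.trans_le (hmono ?_ (by positivity) (by positivity) (by positivity) (by positivity))))
    exact le_mul_of_one_le_right (hTpos k).le (le_max_left _ _)
  · have hxI := ((lobattoNodes_properties hm hn).2 x hx).1
    -- Together with `hG2` this gives `Γ(l+2) / Γ(2l+4) = Γ(m) / (2 (2m+1) Γ(2m))`: the `2` turns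
    -- the constant 4 into 8, and `2m + 1` comes from the bound on the derivative.
    have hG1 : Real.Gamma (l + 2) = m * Real.Gamma m := by
      rw [← Real.Gamma_add_one hm.ne', hm_def]
      congr 1
      ring
    have hG2 : Real.Gamma (2 * l + 4) = (2 * m + 1) * (2 * m * Real.Gamma (2 * m)) := by
      rw [← Real.Gamma_add_one (by linarith), ← Real.Gamma_add_one (by linarith), hm_def]
      congr 1
      ring
    have hpow : ((k : ℝ) + 1) ^ (l + 3) = ((k : ℝ) + 1) ^ m * ((k : ℝ) + 1) ^ 2 := by
      rw [← Real.rpow_natCast, ← Real.rpow_add hnpos, hm_def]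
      congr 1
      push_cast
      ring
    refine (lobatto_deriv_error_le hm hρ hn hu hE hx).trans
      ((mul_le_mul_of_nonneg_left (abs_derivative_lobattoPoly_eval_le hm k hxI) hK0).trans ?_)
    rw [mul_left_comm, hKC, hG1, hG2]
    push_cast
    rw [hpow]
    have h1 : errorConst m ρ L k * derivConst m k ≤ c (k + 1) :=
      mul_le_mul_of_nonneg_left (le_max_right _ _) (hTpos k).le
    have h2 := hmono h1 (S := Real.sqrt (ρ ^ 2 + (ρ ^ 2)⁻¹))
      (X := (1 - ρ⁻¹) ^ 2 * (ρ - ρ⁻¹) ^ 2) (Y := Real.Gamma m / Real.Gamma (2 * m))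
      (Z := ((k : ℝ) + 1) ^ m / ρ ^ (k + 1) * (((k : ℝ) + 1) ^ 2 / (2 * m + 1)))
      (by positivity) (by positivity) (by positivity) (by positivity)
    refine le_trans (le_of_eq ?_) (h2.trans (le_of_eq ?_))
    · rw [derivConst]
      field_simp
    · field_simp
      ring
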